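/- **Setting.** Let $I$ be a finite set and $\Omega=I^{\mathbb N}$ (product of discrete spaces), with elements $\omega=(\omega_1,\omega_2,\ldots)$. A *(planar) model* $\Sigma=((\Phi^{(i)})_{i\in I},(p_i)_{i\in I},\mathbb P)$ consists of, for each $i\in I$, a finite list $\Phi^{(i)}=(f^{(i)}_1,\dots,f^{(i)}_{k_i})$, $k_i\ge 1$, of maps $f^{(i)}_j(z)=\lambda_i z+t^{(i)}_j$ of $\mathbb C$ with $t_j^{(i)}\in\mathbb C$ and $0<|\lambda_i|<1$, a probability vector $p_i=(p^{(i)}_1,\dots,p^{(i)}_{k_i})$ with strictly positive entries, and a Borel probability measure $\mathbb P$ on $\Omega$ (the selection measure). For $\omega\in\Omega$, the measure $\eta^{(\omega)}$ is the image of the product measure $\bigotimes_{n\ge 1}p_{\omega_n}$ on $\prod_{n\ge1}\{1,\dots,k_{\omega_n}\}$ under the map $u\mapsto \sum_{n\ge1}\bigl(\prod_{j=1}^{n-1}\lambda_{\omega_j}\bigr)t^{(\omega_n)}_{u_n}$. The model is *non-degenerate* if there is $i_0\in I$ with $\mathbb P(\omega_1=i_0)>0$ such that not all maps in $\Phi^{(i_0)}$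 are equal. For a Borel probability measure $\mu$ on $\mathbb C$ put $\widehat\mu(\xi)=\int_{\mathbb C}e^{2\pi i\,\mathrm{Re}(z\overline{\xi})}\,d\mu(z)$. For $\sigma>0$ let $\mathcal D_2(\sigma)$ be the set of Borel probability measures $\mu$ on $\mathbb C$ for which there is $C$ with $|\widehat\mu(\xi)|\le C|\xi|^{-\sigma}$ for all $\xi\ne0$, and let $\mathcal D_2=\bigcup_{\sigma>0}\mathcal D_2(\sigma)$. For $z\ne0$, $z^\beta:=e^{\beta\log z}$ with the principal branch of the logarithm (imaginary part in $(-\pi,\pi]$). Let $\mathbb D=\{z\in\mathbb C:|z|<1\}$, $\mathbb D_*=\mathbb D\setminus\{0\}$, and let $\dim_H$ denote Hausdorff dimension. **Theorem.** Let $I$ be a finite set and let $\mathbb P$ be a Bernoulli (i.i.d. product) probability measure on $\Omega=I^{\mathbb N}$. **(A)** For all non-zero complex numbers $\beta_i$, $i\in I$, there exists a Borel set $\mathcal G\subset\Omega\times\mathbb D$ such that 1. for $\mathbb P$-a.e. $\omega\in\Omega$, $\dim_H\{\lambda\in\mathbb D_*:(\omega,\lambda)\notin\mathcal G\}\le 1$;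 2. if $(\omega,\lambda)\in\mathcal G$ and $\Sigma$ is any non-degenerate model with selection measure $\mathbb P$ such that for every $i\in I$ the linear part of the maps in $\Phi^{(i)}$ is $\lambda_i=\lambda^{\beta_i}$ with $|\lambda^{\beta_i}|<1$, then $\eta^{(\omega)}\in\mathcal D_2$. **(B)** Suppose moreover that $\mathbb P$ is fully supported, and fix a letter $i_1\in I$. Let $1<a<b<\infty$, $\eta>0$, $0<p_{\min}\le p_{\max}<1$ and $\alpha>0$, and put $A_{a,b,\eta}=\{z\in\mathbb C: a\le|z|\le b,\ \mathrm{Im}(z)>\eta\}$. There is a constant $\sigma>0$, depending only on $\mathbb P,i_1,a,b,\eta,p_{\min},p_{\max},\alpha$, such that for all complex numbers $(\beta_i)_{i\in I}$ with $\beta_{i_1}=1$ and $$\frac{\log a}{\log b+\pi}\le|\beta_i|\le\frac{\log b+\pi}{\log a}\qquad(i\in I)$$ (natural logarithms) there exists a Borel set $\mathcal G'\subset\Omega\times A_{a,b,\eta}$ such that 1. for $\mathbb P$-a.e. $\omega\in\Omega$, $\dim_H\{\theta\in A_{a,b,\eta}:(\omega,\theta)\notin\mathcal G'\}\le\alpha$;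 2. if $(\omega,\theta)\in\mathcal G'$ and $\Sigma$ is a non-degenerate model with selection measure $\mathbb P$ such that $t^{(i_1)}_j\ne t^{(i_1)}_{j'}$ for some $j,j'\in\{1,\dots,k_{i_1}\}$, $p^{(i_1)}_j\in[p_{\min},p_{\max}]$ for all $j\in\{1,\dots,k_{i_1}\}$, and $\lambda_i=\theta^{-\beta_i}$ with $a\le|\lambda_i|^{-1}\le b$ for all $i\in I$, then $\eta^{(\omega)}\in\mathcal D_2(\sigma)$. -/

import Mathlib

open MeasureTheory

noncomputable section

/-- A planar model over the finite alphabet `I`: for each `i : I`, a homogeneous, orientation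
preserving, uniformly contracting iterated function system
`z ↦ lam i * z + t i j`, `j : Fin (k i)`, together with a probability vector `p i` with strictly
positive entries, and a Borel probability measure `selection` on `Ω = ℕ → I`.
(That `1 ≤ k i` follows from the existence of the probability vector `p i`.)
The alphabet carries the discrete σ-algebra wherever models are used. -/
structure PlanarModel (I : Type*) [Finite I] [MeasurableSpace I] where
  k : I → ℕ
  lam : I → ℂ
  lam_ne_zero : ∀ i, lam i ≠ 0
  norm_lam_lt_one : ∀ i, ‖lam i‖ < 1
  t : (i : I) → Fin (k i) → ℂ
  p : (i : I) → PMF (Fin (k i))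
  p_pos : ∀ i j, 0 < p i j
  selection : Measure (ℕ → I)
  isProbabilityMeasure_selection : IsProbabilityMeasure selection

namespace PlanarModel

variable {I : Type*} [Finite I] [MeasurableSpace I] (M : PlanarModel I)

/-- The map `z ↦ lam i * z + t i j`. -/
def map (i : I) (j : Fin (M.k i)) (z : ℂ) : ℂ := M.lam i * z + M.t i j

/-- Some letter is the first letter with positive probability and its iterated function system has
two different maps. (Sequences are indexed from `0`.) -/
def NonDegenerate : Prop :=
  ∃ i₀ : I, 0 < M.selection {ω | ω 0 = i₀} ∧ ∃ j j' : Fin (M.k i₀), M.map i₀ j ≠ M.map i₀ j'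

/-- The natural projection `u ↦ ∑ₙ (∏_{j < n} lam (ω j)) * t (ω n) (u n)` of the symbolic space
attached to `ω`; the series converges absolutely. -/
def coding (ω : ℕ → I) (u : (n : ℕ) → Fin (M.k (ω n))) : ℂ :=
  ∑' n : ℕ, (∏ j ∈ Finset.range n, M.lam (ω j)) * M.t (ω n) (u n)

/-- The infinite product of the probability vectors `p (ω n)`. -/
def symbolicMeasure (ω : ℕ → I) : Measure ((n : ℕ) → Fin (M.k (ω n))) :=
  Measure.infinitePi fun n => (M.p (ω n)).toMeasure

/-- The random measure generated by the model at `ω`: the push-forward of the product measure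
under the natural projection. -/
def randomMeasure (ω : ℕ → I) : Measure ℂ :=
  (M.symbolicMeasure ω).map (M.coding ω)

end PlanarModel

/-- The Bernoulli measure on `ℕ → I` with marginal `q`. -/
def bernoulliMeasure {I : Type*} [MeasurableSpace I] (q : PMF I) : Measure (ℕ → I) :=
  Measure.infinitePi fun _ : ℕ => q.toMeasure

/-- The Fourier transform `ξ ↦ ∫ exp (2 π i Re (z * conj ξ)) dμ(z)` of a measure on the plane. -/
def planarFourier (μ : Measure ℂ) (ξ : ℂ) : ℂ :=
  ∫ z, Complex.exp (2 * Real.pi * Complex.I * ((z * (starRingEnd ℂ) ξ).re : ℂ)) ∂μ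

/-- The Borel probability measures `μ` on the plane whose Fourier transform is
`O_μ (‖ξ‖ ^ (-σ))`. -/
def FourierDecayClass (σ : ℝ) : Set (Measure ℂ) :=
  {μ | IsProbabilityMeasure μ ∧
    ∃ C : ℝ, ∀ ξ : ℂ, ξ ≠ 0 → ‖planarFourier μ ξ‖ ≤ C * ‖ξ‖ ^ (-σ)}

/-- The Borel probability measures on the plane with power Fourier decay. -/
def PowerFourierDecay : Set (Measure ℂ) := ⋃ σ : Set.Ioi (0 : ℝ), FourierDecayClass σ

/-- The region `{z : a ≤ |z| ≤ b, Im z > η}`. -/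
def halfAnnulus (a b η : ℝ) : Set ℂ := {z | a ≤ ‖z‖ ∧ ‖z‖ ≤ b ∧ η < z.im}

end

/-!
# Power Fourier decay of random planar self-similar measures

The Fourier transform of `η^(ω)` at `ξ` is the infinite product over `n` of the Fourier transforms
of the discrete measures `∑ⱼ p (ω n) j δ_{t (ω n) j}` at `conj (∏_{k < n} lam (ω k)) ξ`. If the
letter `i₁` has two different translations, a factor with `ω n = i₁` is at most a constant smaller
than one unless the real part of `τ * conj ξ * ∏_{k < n} lam (ω k)` is close to an integer, where
`τ` is the difference of the translations. Hence power decay at `ξ` can fail only if these real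
parts are close to integers for most `n`, and an Erdős–Kahane argument shows that this happens for
few parameters only.

The argument is carried out in a logarithmic parameter `w`, in which the letter `i` contracts by
`exp (-(w * β i))` with `β i₁ = 1`; so no branch of the logarithm enters, and `θ = exp w` is the
expansion of the letter `i₁`. A frequency `z` of moderate size is expanded by the letters of `ω`,
read backwards in `N` blocks of length `L`. Along a run of four letters `i₁` the real parts of the
frequency are those of a geometric progression with ratio `θ`, and they determine the frequency
and `θ`, because `θ` is not real (`exists_isRecoveryConst`). So if two parameters are already known
to be close, and both have real parts close to integers along such a run, these integers agree and the
parameters are as close, relative to the new and larger frequency, as before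
(`ErdosKahane.Close.of_goodBlock`): a *good block* does not increase the number of sets needed to
cover the possible parameters. A block which is not good multiplies this number by at most
`b ^ (8 * L)` (`ErdosKahane.hasCover_close_add`), and recording which blocks are good multiplies it
by `2 ^ N`. If at most `δ N` blocks are not good, with `δ` small and then `L` large, the resulting
cover by sets of diameter about `a ^ (-N * L)` gives dimension at most `α`
(`ErdosKahane.exists_dimH_resonant_le`).

By the strong law of large numbers, almost surely all but a proportion `δ / 2` of the blocks contain
a run of `i₁`, once `L` is large (`eventually_ae_few_blocks_without_run`). At a parameter which is
not exceptional, at least a proportion `δ / 2` of the blocks therefore contributes a factor bounded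
away from one, uniformly in the frequency, which is power decay
(`ErdosKahane.randomMeasure_mem_fourierDecayClass`). Taking closures of the exceptional sets of each
level makes the set of good pairs Borel without affecting the covers.

The precise statement follows with `w = log θ`. For the qualitative one, the points of the disc are
distributed over countably many regions to which the precise result applies, for each possible
letter `i₁`; what remains are the curves on which `exp w` is real, of dimension one.
-/

noncomputable section

open Filter Topology

/-! ### Fourier transforms of the random measures -/

namespace PlanarModel

variable {I : Type*} [Finite I] [MeasurableSpace I] (M : PlanarModel I)

/-- The Fourier transform of the discrete measure `∑ⱼ p i j δ_{t i j}`, with the frequency already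
conjugated. -/
def letterFourier (i : I) (ζ : ℂ) : ℂ :=
  ∑ j, ((M.p i j).toReal : ℂ) * Complex.exp (2 * Real.pi * Complex.I * ((M.t i j * ζ).re : ℂ))

lemma sum_toReal_p (i : I) : ∑ j, (M.p i j).toReal = 1 := by
  have h := (M.p i).tsum_coe
  rw [tsum_fintype] at h
  rw [← ENNReal.toReal_sum (fun j _ => (M.p i).apply_ne_top j), h, ENNReal.toReal_one]

lemma norm_exp_two_pi_I (x : ℝ) : ‖Complex.exp (2 * Real.pi * Complex.I * (x : ℂ))‖ = 1 := by
  have : (2 * Real.pi * Complex.I * (x : ℂ)) = ((2 * Real.pi * x : ℝ) : ℂ) * Complex.I := by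
    push_cast; ring
  rw [this, Complex.norm_exp_ofReal_mul_I]

lemma norm_letterFourier_le_one (i : I) (ζ : ℂ) : ‖M.letterFourier i ζ‖ ≤ 1 := by
  refine (norm_sum_le _ _).trans ?_
  rw [← M.sum_toReal_p i]
  refine Finset.sum_le_sum fun j _ => ?_
  rw [norm_mul, norm_exp_two_pi_I, mul_one, Complex.norm_real, Real.norm_eq_abs,
    abs_of_nonneg ENNReal.toReal_nonneg]

/-- The `n`-th summand of the coding map. -/
def digit (ω : ℕ → I) (n : ℕ) (x : Fin (M.k (ω n))) : ℂ :=
  (∏ j ∈ Finset.range n, M.lam (ω j)) * M.t (ω n) x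

lemma summable_digit (ω : ℕ → I) (u : (n : ℕ) → Fin (M.k (ω n))) :
    Summable fun n => M.digit ω n (u n) := by
  have : Nonempty I := ⟨ω 0⟩
  obtain ⟨i₀, hi₀⟩ := Finite.exists_max fun i => ‖M.lam i‖
  have hT : ∃ T : ℝ, ∀ i, ∀ j, ‖M.t i j‖ ≤ T := by
    cases nonempty_fintype I
    refine ⟨∑ i, ∑ j, ‖M.t i j‖, fun i j => ?_⟩
    refine (Finset.single_le_sum (f := fun j => ‖M.t i j‖) (fun _ _ => norm_nonneg _)
      (Finset.mem_univ j)).trans ?_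
    exact Finset.single_le_sum (f := fun i => ∑ j, ‖M.t i j‖)
      (fun _ _ => Finset.sum_nonneg fun _ _ => norm_nonneg _) (Finset.mem_univ i)
  obtain ⟨T, hT⟩ := hT
  refine Summable.of_norm_bounded (g := fun n => ‖M.lam i₀‖ ^ n * T)
    ((summable_geometric_of_lt_one (norm_nonneg _) (M.norm_lam_lt_one i₀)).mul_right T) fun n => ?_
  rw [digit, norm_mul, norm_prod]
  refine mul_le_mul ?_ (hT _ _) (norm_nonneg _) (by positivity)
  refine (Finset.prod_le_prod (fun _ _ => norm_nonneg _) fun j _ => hi₀ (ω j)).trans ?_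
  simp

lemma measurable_digit (ω : ℕ → I) (n : ℕ) :
    Measurable fun u : (n : ℕ) → Fin (M.k (ω n)) => M.digit ω n (u n) :=
  (measurable_of_countable (M.digit ω n)).comp (measurable_pi_apply n)

lemma tendsto_sum_digit (ω : ℕ → I) (u : (n : ℕ) → Fin (M.k (ω n))) :
    Tendsto (fun m => ∑ n ∈ Finset.range m, M.digit ω n (u n)) atTop (𝓝 (M.coding ω u)) :=
  (M.summable_digit ω u).hasSum.tendsto_sum_nat

lemma measurable_coding (ω : ℕ → I) : Measurable (M.coding ω) :=
  measurable_of_tendsto_metrizable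
    (fun m => Finset.measurable_sum (Finset.range m) fun n _ => M.measurable_digit ω n)
    (tendsto_pi_nhds.2 fun u => M.tendsto_sum_digit ω u)

instance (ω : ℕ → I) : IsProbabilityMeasure (M.symbolicMeasure ω) := by
  unfold symbolicMeasure; infer_instance

lemma isProbabilityMeasure_randomMeasure (ω : ℕ → I) :
    IsProbabilityMeasure (M.randomMeasure ω) :=
  Measure.isProbabilityMeasure_map (M.measurable_coding ω).aemeasurable

/-- The character `z ↦ exp (2 π i Re (z * ζ))`. -/
def planarChar (ζ z : ℂ) : ℂ := Complex.exp (2 * Real.pi * Complex.I * ((z * ζ).re : ℂ))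

lemma continuous_planarChar (ζ : ℂ) : Continuous (planarChar ζ) := by
  unfold planarChar; fun_prop

lemma norm_planarChar (ζ z : ℂ) : ‖planarChar ζ z‖ = 1 := norm_exp_two_pi_I _

lemma planarChar_sum (ζ : ℂ) (m : ℕ) (z : ℕ → ℂ) :
    planarChar ζ (∑ n ∈ Finset.range m, z n) = ∏ n : Fin m, planarChar ζ (z n) := by
  rw [Fin.prod_univ_eq_prod_range (fun n => planarChar ζ (z n)) m]
  simp only [planarChar]
  rw [← Complex.exp_sum, ← Finset.mul_sum, Finset.sum_mul, Complex.re_sum]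
  push_cast
  rfl

lemma integral_planarChar_sum_digit (ω : ℕ → I) (ζ : ℂ) (m : ℕ) :
    ∫ u, planarChar ζ (∑ n ∈ Finset.range m, M.digit ω n (u n)) ∂(M.symbolicMeasure ω) =
      ∏ n ∈ Finset.range m,
        M.letterFourier (ω n) ((∏ j ∈ Finset.range n, M.lam (ω j)) * ζ) := by
  have hind : ProbabilityTheory.iIndepFun (fun (n : Fin m) (u : (n : ℕ) → Fin (M.k (ω n))) => u n)
      (M.symbolicMeasure ω) :=
    (ProbabilityTheory.iIndepFun_infinitePi (P := fun n => (M.p (ω n)).toMeasure) (X := fun n x => x)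
      (fun n => measurable_id)).precomp Fin.val_injective
  have hf : ∀ n : ℕ, Measurable fun x : Fin (M.k (ω n)) => planarChar ζ (M.digit ω n x) :=
    fun n => measurable_of_countable _
  simp_rw [fun u : (n : ℕ) → Fin (M.k (ω n)) => planarChar_sum ζ m fun n => M.digit ω n (u n)]
  rw [hind.integral_fun_prod_comp (f := fun (n : Fin m) x => planarChar ζ (M.digit ω n x))
    (fun n => (measurable_pi_apply (n : ℕ)).aemeasurable)
    (fun n => (hf n).aestronglyMeasurable),
    ← Fin.prod_univ_eq_prod_range (fun n => M.letterFourier (ω n)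
      ((∏ j ∈ Finset.range n, M.lam (ω j)) * ζ)) m]
  refine Finset.prod_congr rfl fun n _ => ?_
  have h1 : (M.symbolicMeasure ω).map (fun u => u n) = (M.p (ω n)).toMeasure :=
    Measure.infinitePi_map_eval (fun n => (M.p (ω n)).toMeasure) (n : ℕ)
  rw [← integral_map (φ := fun u : (n : ℕ) → Fin (M.k (ω n)) => u n)
    (f := fun x => planarChar ζ (M.digit ω n x)) (measurable_pi_apply (n : ℕ)).aemeasurable
    (hf n).aestronglyMeasurable, h1, PMF.integral_eq_sum]
  refine Finset.sum_congr rfl fun j _ => ?_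
  rw [Complex.real_smul, planarChar, digit]
  congr 5
  ring

/-- The Fourier transform of the random measure is an infinite product of factors of modulus at
most one, hence bounded by each finite partial product. -/
lemma norm_planarFourier_randomMeasure_le (ω : ℕ → I) (ξ : ℂ) (N : ℕ) :
    ‖planarFourier (M.randomMeasure ω) ξ‖ ≤ ∏ n ∈ Finset.range N,
      ‖M.letterFourier (ω n) ((∏ j ∈ Finset.range n, M.lam (ω j)) * starRingEnd ℂ ξ)‖ := by
  set ζ := starRingEnd ℂ ξ
  have h0 : planarFourier (M.randomMeasure ω) ξ =
      ∫ u, planarChar ζ (M.coding ω u) ∂(M.symbolicMeasure ω) :=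
    integral_map (f := planarChar ζ) (M.measurable_coding ω).aemeasurable
      (continuous_planarChar ζ).aestronglyMeasurable
  have hlim : Tendsto (fun m => ∫ u, planarChar ζ (∑ n ∈ Finset.range m, M.digit ω n (u n))
      ∂(M.symbolicMeasure ω)) atTop (𝓝 (planarFourier (M.randomMeasure ω) ξ)) := by
    rw [h0]
    refine tendsto_integral_of_dominated_convergence (fun _ => 1) (fun m => ?_)
      (integrable_const _) (fun m => ?_) ?_
    · exact ((continuous_planarChar ζ).measurable.comp (Finset.measurable_sum (Finset.range m)
        fun n _ => M.measurable_digit ω n)).aestronglyMeasurable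
    · exact Eventually.of_forall fun u => (norm_planarChar _ _).le
    · exact Eventually.of_forall fun u =>
        ((continuous_planarChar ζ).tendsto _).comp (M.tendsto_sum_digit ω u)
  refine le_of_tendsto hlim.norm ?_
  filter_upwards [eventually_ge_atTop N] with m hm
  rw [integral_planarChar_sum_digit, norm_prod]
  exact Finset.prod_le_prod_of_subset_of_le_one (Finset.range_mono hm)
    (fun _ _ => norm_nonneg _) (fun n _ _ => M.norm_letterFourier_le_one _ _)

/-- Two unit vectors whose phases differ by an amount at distance at least `ρ` from the integers
do not add up to more than `2 cos (π ρ)`. -/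
lemma norm_exp_add_exp_le {x y ρ : ℝ} (h0 : 0 ≤ ρ) (h : ρ ≤ |x - y - round (x - y)|) :
    ‖Complex.exp (2 * Real.pi * Complex.I * (x : ℂ)) +
      Complex.exp (2 * Real.pi * Complex.I * (y : ℂ))‖ ≤ 2 * Real.cos (Real.pi * ρ) := by
  have h1 : Complex.exp (2 * Real.pi * Complex.I * (x : ℂ)) +
      Complex.exp (2 * Real.pi * Complex.I * (y : ℂ)) =
      Complex.exp (((Real.pi * (x + y) : ℝ) : ℂ) * Complex.I) *
        ((2 * Real.cos (Real.pi * (x - y)) : ℝ) : ℂ) := by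
    push_cast
    rw [Complex.two_cos, mul_add, ← Complex.exp_add, ← Complex.exp_add]
    congr 2 <;> ring
  rw [h1, norm_mul, Complex.norm_exp_ofReal_mul_I, one_mul, Complex.norm_real, Real.norm_eq_abs,
    abs_mul, abs_two]
  have h2 : |Real.cos (Real.pi * (x - y))| = Real.cos (Real.pi * |x - y - round (x - y)|) := by
    have h3 : Real.pi * (x - y) = Real.pi * (x - y - round (x - y)) + round (x - y) * Real.pi := by
      ring
    rw [h3, Real.cos_add_int_mul_pi, abs_mul, abs_zpow, abs_neg, abs_one, one_zpow, one_mul,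
      ← Real.cos_abs, abs_mul, abs_of_pos Real.pi_pos, abs_of_nonneg]
    apply Real.cos_nonneg_of_neg_pi_div_two_le_of_le
    · have := Real.pi_pos; have := abs_nonneg (x - y - round (x - y)); nlinarith
    · have := abs_sub_round (x - y); nlinarith [Real.pi_pos]
  rw [h2]
  have := abs_sub_round (x - y)
  gcongr 2 * ?_
  apply Real.cos_le_cos_of_nonneg_of_le_pi
  · positivity
  · nlinarith [Real.pi_pos]
  · gcongr

/-- Quantitative gain of a letter whose IFS has two different translations `t i j ≠ t i j'`, at
frequencies where `Re ((t i j - t i j') * ζ)` is not close to an integer. -/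
lemma norm_letterFourier_le (i : I) (ζ : ℂ) {j j' : Fin (M.k i)} (hjj : j ≠ j') {pm ρ : ℝ}
    (hpm : 0 ≤ pm) (hj : pm ≤ (M.p i j).toReal) (hj' : pm ≤ (M.p i j').toReal) (h0 : 0 ≤ ρ)
    (h : ρ ≤ |((M.t i j - M.t i j') * ζ).re - round ((M.t i j - M.t i j') * ζ).re|) :
    ‖M.letterFourier i ζ‖ ≤ 1 - 2 * pm * (1 - Real.cos (Real.pi * ρ)) := by
  set u : Fin (M.k i) → ℂ :=
    fun j => Complex.exp (2 * Real.pi * Complex.I * ((M.t i j * ζ).re : ℂ)) with hu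
  have hu1 : ∀ j, ‖u j‖ = 1 := fun j => norm_exp_two_pi_I _
  have hadd : ‖u j + u j'‖ ≤ 2 * Real.cos (Real.pi * ρ) := by
    apply norm_exp_add_exp_le h0
    rwa [sub_mul, Complex.sub_re] at h
  have hsplit : ∀ f : Fin (M.k i) → ℝ, ∑ l, f l = f j + f j' + ∑ l ∈ Finset.univ \ {j, j'}, f l :=
    fun f => by
      rw [← Finset.sum_pair hjj, add_comm, Finset.sum_sdiff (Finset.subset_univ _)]
  have hsplit' : M.letterFourier i ζ = pm * (u j + u j') +
      (((M.p i j).toReal - pm : ℝ) * u j + ((M.p i j').toReal - pm : ℝ) * u j') +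
      ∑ l ∈ Finset.univ \ {j, j'}, ((M.p i l).toReal : ℂ) * u l := by
    rw [letterFourier, ← Finset.sum_sdiff (Finset.subset_univ {j, j'}), Finset.sum_pair hjj]
    push_cast
    ring
  have h1 := M.sum_toReal_p i
  rw [hsplit] at h1
  rw [hsplit']
  refine (norm_add₃_le).trans ?_
  have e1 : ‖(pm : ℂ) * (u j + u j')‖ ≤ pm * (2 * Real.cos (Real.pi * ρ)) := by
    rw [norm_mul, Complex.norm_real, Real.norm_eq_abs, abs_of_nonneg hpm]
    gcongr
  have e2 : ‖(((M.p i j).toReal - pm : ℝ) : ℂ) * u j + ((M.p i j').toReal - pm : ℝ) * u j'‖ ≤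
      ((M.p i j).toReal - pm) + ((M.p i j').toReal - pm) := by
    refine (norm_add_le _ _).trans ?_
    rw [norm_mul, norm_mul, hu1, hu1, Complex.norm_real, Complex.norm_real, Real.norm_eq_abs,
      Real.norm_eq_abs, abs_of_nonneg (sub_nonneg.2 hj), abs_of_nonneg (sub_nonneg.2 hj'), mul_one,
      mul_one]
  have e3 : ‖∑ l ∈ Finset.univ \ {j, j'}, ((M.p i l).toReal : ℂ) * u l‖ ≤
      ∑ l ∈ Finset.univ \ {j, j'}, (M.p i l).toReal := by
    refine (norm_sum_le _ _).trans (Finset.sum_le_sum fun l _ => ?_)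
    rw [norm_mul, hu1, mul_one, Complex.norm_real, Real.norm_eq_abs,
      abs_of_nonneg ENNReal.toReal_nonneg]
  linarith

end PlanarModel

/-! ### Recovering a geometric progression from its real parts -/

/-- If the real parts of `Z θ ^ k` and `Z' θ' ^ k`, `k < 4`, agree up to `r`, then `Z, Z'` agree up
to `C r` and `θ, θ'` agree up to `C r / ‖Z'‖`. The ratios `θ, θ'` are at most `b` in modulus, at
distance at least `η` from the real axis, and on the same side of it because they are `η`-close. -/
def IsRecoveryConst (b η C : ℝ) : Prop :=
  1 ≤ C ∧ ∀ (Z θ Z' θ' : ℂ) (r : ℝ), 0 ≤ r → Z' ≠ 0 → ‖θ‖ ≤ b → ‖θ'‖ ≤ b →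
    η ≤ |θ.im| → η ≤ |θ'.im| → ‖θ - θ'‖ ≤ η →
    (∀ k < 4, |(Z * θ ^ k).re - (Z' * θ' ^ k).re| ≤ r) →
    ‖Z - Z'‖ ≤ C * r ∧ ‖θ - θ'‖ * ‖Z'‖ ≤ C * r

set_option maxHeartbeats 1000000 in
/-- The real parts of `Z θ ^ k` satisfy a linear recurrence with coefficients `2 Re θ` and
`‖θ‖ ^ 2`, and the determinant of the linear system for these coefficients is, up to sign,
`‖Z‖ ^ 2 * (Im θ) ^ 2`; this is where non-real ratios are needed. -/
lemma exists_isRecoveryConst (b η : ℝ) (hb : 1 ≤ b) (hη : 0 < η) :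
    ∃ C : ℝ, IsRecoveryConst b η C := by
  set A : ℝ := 2 * b * (1 + b) ^ 3 / η ^ 3 with hA
  have hA0 : 0 ≤ A := by positivity
  have hA1 : 0 ≤ (b + 1 + 2 * A) / η := by positivity
  refine ⟨1 + A + (b + 1 + 2 * A) / η, by linarith, ?_⟩
  intro Z θ Z' θ' r hr hZ' hθ hθ' him him' hclose hx
  set T := ‖Z'‖
  have hT : 0 < T := norm_pos_iff.2 hZ'
  -- `t`, `d` and `t'`, `d'` are the coefficients of the two recurrences
  obtain ⟨t, ht⟩ : ∃ v, v = 2 * θ.re := ⟨_, rfl⟩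
  obtain ⟨d, hd⟩ : ∃ v, v = θ.re ^ 2 + θ.im ^ 2 := ⟨_, rfl⟩
  obtain ⟨t', ht'⟩ : ∃ v, v = 2 * θ'.re := ⟨_, rfl⟩
  obtain ⟨d', hd'⟩ : ∃ v, v = θ'.re ^ 2 + θ'.im ^ 2 := ⟨_, rfl⟩
  have h0 := hx 0 (by norm_num)
  have h1 := hx 1 (by norm_num)
  have h2 := hx 2 (by norm_num)
  have h3 := hx 3 (by norm_num)
  obtain ⟨x0, hx0⟩ : ∃ v, v = (Z * θ ^ 0).re := ⟨_, rfl⟩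
  obtain ⟨x1, hx1⟩ : ∃ v, v = (Z * θ ^ 1).re := ⟨_, rfl⟩
  obtain ⟨x2, hx2⟩ : ∃ v, v = (Z * θ ^ 2).re := ⟨_, rfl⟩
  obtain ⟨x3, hx3⟩ : ∃ v, v = (Z * θ ^ 3).re := ⟨_, rfl⟩
  obtain ⟨y0, hy0⟩ : ∃ v, v = (Z' * θ' ^ 0).re := ⟨_, rfl⟩
  obtain ⟨y1, hy1⟩ : ∃ v, v = (Z' * θ' ^ 1).re := ⟨_, rfl⟩
  obtain ⟨y2, hy2⟩ : ∃ v, v = (Z' * θ' ^ 2).re := ⟨_, rfl⟩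
  obtain ⟨y3, hy3⟩ : ∃ v, v = (Z' * θ' ^ 3).re := ⟨_, rfl⟩
  rw [← hx0, ← hy0] at h0
  rw [← hx1, ← hy1] at h1
  rw [← hx2, ← hy2] at h2
  rw [← hx3, ← hy3] at h3
  have rx2 : x2 = t * x1 - d * x0 := by
    simp only [hx2, hx1, hx0, ht, hd, pow_succ, pow_zero, Complex.mul_re, Complex.mul_im,
      Complex.one_re, Complex.one_im]; ring
  have rx3 : x3 = t * x2 - d * x1 := by
    simp only [hx2, hx1, hx3, ht, hd, pow_succ, pow_zero, Complex.mul_re, Complex.mul_im,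
      Complex.one_re, Complex.one_im]; ring
  have ry2 : y2 = t' * y1 - d' * y0 := by
    simp only [hy2, hy1, hy0, ht', hd', pow_succ, pow_zero, Complex.mul_re, Complex.mul_im,
      Complex.one_re, Complex.one_im]; ring
  have ry3 : y3 = t' * y2 - d' * y1 := by
    simp only [hy2, hy1, hy3, ht', hd', pow_succ, pow_zero, Complex.mul_re, Complex.mul_im,
      Complex.one_re, Complex.one_im]; ring
  have hT2 : T ^ 2 = Z'.re ^ 2 + Z'.im ^ 2 := by
    rw [Complex.sq_norm, Complex.normSq_apply]; ring
  have hdet : y1 ^ 2 - y0 * y2 = T ^ 2 * θ'.im ^ 2 := by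
    rw [hT2]
    simp only [hy2, hy1, hy0, pow_succ, pow_zero, Complex.mul_re, Complex.mul_im,
      Complex.one_re, Complex.one_im]; ring
  have hθre : |θ.re| ≤ b := (Complex.abs_re_le_norm θ).trans hθ
  have hd_le : d ≤ b ^ 2 := by
    have : ‖θ‖ ^ 2 = d := by rw [Complex.sq_norm, Complex.normSq_apply, hd]; ring
    rw [← this]; gcongr
  have hd_nonneg : 0 ≤ d := by rw [hd]; positivity
  have ht_le : |t| ≤ 2 * b := by rw [ht, abs_mul, abs_two]; linarith
  have herr : ∀ u v w : ℝ, |u| ≤ r → |v| ≤ r → |w| ≤ r →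
      |w - t * v + d * u| ≤ (1 + b) ^ 2 * r := fun u v w hu hv hw => by
    calc |w - t * v + d * u| ≤ |w| + |t * v| + |d * u| :=
          (abs_add_le _ _).trans (by gcongr; exact abs_sub _ _)
      _ = |w| + |t| * |v| + d * |u| := by
          rw [abs_mul t, abs_mul d, abs_of_nonneg hd_nonneg]
      _ ≤ r + 2 * b * r + b ^ 2 * r := by gcongr
      _ = (1 + b) ^ 2 * r := by ring
  have e0 : |(t' - t) * y1 - (d' - d) * y0| ≤ (1 + b) ^ 2 * r := by
    have := herr _ _ _ h0 h1 h2
    rw [← abs_neg] at this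
    convert this using 2
    rw [rx2, ry2]; ring
  have e1 : |(t' - t) * y2 - (d' - d) * y1| ≤ (1 + b) ^ 2 * r := by
    have := herr _ _ _ h1 h2 h3
    rw [← abs_neg] at this
    convert this using 2
    rw [rx3, ry3]; ring
  have hy : ∀ k, |(Z' * θ' ^ k).re| ≤ T * b ^ k := fun k => by
    refine (Complex.abs_re_le_norm _).trans ?_
    rw [norm_mul, norm_pow]; gcongr
  have b0 : |y0| ≤ T := by rw [hy0]; exact (hy 0).trans_eq (by ring)
  have b1 : |y1| ≤ T * b := by rw [hy1]; exact (hy 1).trans_eq (by ring)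
  have b2 : |y2| ≤ T * b ^ 2 := by rw [hy2]; exact hy 2
  have him2 : η ^ 2 ≤ θ'.im ^ 2 := by rw [← sq_abs θ'.im]; gcongr
  -- Cramer's rule
  have hc : ∀ D s s' : ℝ, ∀ u v : ℝ, D * (T ^ 2 * θ'.im ^ 2) = s * u - s' * v →
      |s| ≤ (1 + b) ^ 2 * r → |s'| ≤ (1 + b) ^ 2 * r → ∀ B, |u| + |v| ≤ T * B →
      |D| * T ≤ (1 + b) ^ 2 * r * B / η ^ 2 := by
    intro D s s' u v h hs hs' B hB
    rw [le_div_iff₀ (by positivity)]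
    have h4 : |D| * (T ^ 2 * θ'.im ^ 2) ≤ (1 + b) ^ 2 * r * (T * B) := by
      calc |D| * (T ^ 2 * θ'.im ^ 2) = |s * u - s' * v| := by
            rw [← h, abs_mul, abs_of_nonneg (by positivity : 0 ≤ T ^ 2 * θ'.im ^ 2)]
        _ ≤ |s| * |u| + |s'| * |v| := by rw [← abs_mul, ← abs_mul]; exact abs_sub _ _
        _ ≤ (1 + b) ^ 2 * r * |u| + (1 + b) ^ 2 * r * |v| := by gcongr
        _ = (1 + b) ^ 2 * r * (|u| + |v|) := by ring
        _ ≤ _ := by gcongr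
    have h5 : T * (|D| * T * η ^ 2) ≤ T * ((1 + b) ^ 2 * r * B) := by
      calc T * (|D| * T * η ^ 2) = |D| * (T ^ 2 * η ^ 2) := by ring
        _ ≤ |D| * (T ^ 2 * θ'.im ^ 2) := by gcongr
        _ ≤ _ := h4
        _ = _ := by ring
    exact le_of_mul_le_mul_left h5 hT
  have ht_diff := hc (t' - t) _ _ y1 y0 (by rw [← hdet]; ring) e0 e1 (1 + b) (by linarith)
  have hd_diff := hc (d' - d) _ _ y2 y1 (by rw [← hdet]; ring) e0 e1 (b * (1 + b))
    ((add_le_add b2 b1).trans_eq (by ring))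
  -- `θ'` is an approximate root of the quadratic polynomial with roots `θ` and `conj θ`
  have hroot : (θ' - θ) * (θ' - starRingEnd ℂ θ) = ((t' - t : ℝ) : ℂ) * θ' - ((d' - d : ℝ) : ℂ) := by
    apply Complex.ext
    · simp only [Complex.sub_re, Complex.mul_re, Complex.sub_im, Complex.ofReal_re,
        Complex.ofReal_im, Complex.conj_re, Complex.conj_im]
      rw [ht, ht', hd, hd']; ring
    · simp only [Complex.sub_re, Complex.sub_im, Complex.mul_im, Complex.ofReal_re,
        Complex.ofReal_im, Complex.conj_re, Complex.conj_im]
      rw [ht, ht']; ring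
  have hsep : η ≤ ‖θ' - starRingEnd ℂ θ‖ := by
    refine le_trans ?_ (Complex.abs_im_le_norm _)
    have h6 := (Complex.abs_im_le_norm (θ - θ')).trans hclose
    simp only [Complex.sub_im, Complex.conj_im, sub_neg_eq_add] at h6 ⊢
    rw [abs_le] at h6
    rcases le_abs.1 him with h | h
    · rw [le_abs]; left; linarith
    · rw [le_abs]; right; linarith
  have hθd : ‖θ - θ'‖ * T ≤ A * r := by
    have h7 : ‖θ - θ'‖ * η ≤ |t' - t| * b + |d' - d| := by
      calc ‖θ - θ'‖ * η ≤ ‖θ' - θ‖ * ‖θ' - starRingEnd ℂ θ‖ := by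
            rw [norm_sub_rev]; gcongr
        _ = ‖((t' - t : ℝ) : ℂ) * θ' - ((d' - d : ℝ) : ℂ)‖ := by rw [← norm_mul, hroot]
        _ ≤ |t' - t| * ‖θ'‖ + |d' - d| := by
            refine (norm_sub_le _ _).trans ?_
            rw [norm_mul, Complex.norm_real, Complex.norm_real, Real.norm_eq_abs, Real.norm_eq_abs]
        _ ≤ _ := by gcongr
    have h8 : ‖θ - θ'‖ * T * η ≤ A * r * η := by
      calc ‖θ - θ'‖ * T * η = ‖θ - θ'‖ * η * T := by ring
        _ ≤ (|t' - t| * b + |d' - d|) * T := by gcongr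
        _ = |t' - t| * T * b + |d' - d| * T := by ring
        _ ≤ (1 + b) ^ 2 * r * (1 + b) / η ^ 2 * b + (1 + b) ^ 2 * r * (b * (1 + b)) / η ^ 2 := by
            gcongr
        _ = A * r * η := by rw [hA]; field_simp; ring
    exact le_of_mul_le_mul_right h8 hη
  have hre : |Z.re - Z'.re| ≤ r := by simpa [hx0, hy0] using h0
  have him3 : |Z.im - Z'.im| ≤ (b + 1 + 2 * A) / η * r := by
    have h9 : θ.im * (Z.im - Z'.im) = (Z.re - Z'.re) * θ.re + Z'.re * (θ - θ').re -
        Z'.im * (θ - θ').im - (x1 - y1) := by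
      simp only [hx1, hy1, pow_one, Complex.mul_re, Complex.sub_re, Complex.sub_im]; ring
    have h10 : |θ.im * (Z.im - Z'.im)| ≤ (b + 1 + 2 * A) * r := by
      rw [h9]
      calc _ ≤ |Z.re - Z'.re| * |θ.re| + |Z'.re| * |(θ - θ').re| + |Z'.im| * |(θ - θ').im| +
            |x1 - y1| := by
            rw [← abs_mul, ← abs_mul, ← abs_mul]
            refine (abs_sub _ _).trans ?_
            gcongr
            refine (abs_sub _ _).trans ?_
            gcongr
            exact abs_add_le _ _
        _ ≤ r * b + T * ‖θ - θ'‖ + T * ‖θ - θ'‖ + r := by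
            gcongr
            · exact Complex.abs_re_le_norm _
            · exact Complex.abs_re_le_norm _
            · exact Complex.abs_im_le_norm _
            · exact Complex.abs_im_le_norm _
        _ ≤ _ := by linarith
    rw [abs_mul] at h10
    rw [div_mul_eq_mul_div, le_div_iff₀ hη]
    calc |Z.im - Z'.im| * η ≤ |Z.im - Z'.im| * |θ.im| := by gcongr
      _ ≤ _ := by linarith
  constructor
  · calc ‖Z - Z'‖ ≤ |(Z - Z').re| + |(Z - Z').im| := Complex.norm_le_abs_re_add_abs_im _
      _ ≤ r + (b + 1 + 2 * A) / η * r := by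
          rw [Complex.sub_re, Complex.sub_im]; gcongr
      _ ≤ _ := by linarith [mul_nonneg hA0 hr]
  · linarith [mul_nonneg hA1 hr]

/-! ### Covers by sets of controlled size -/

/-- The set `A` is a union of at most `c` subsets on each of which the relation `rel` holds between
any two points. With `rel x y := dist x y ≤ d` this says that `A` is covered by `c` sets of
diameter at most `d`. -/
def HasCover {X : Type*} (c : ℕ) (A : Set X) (rel : X → X → Prop) : Prop :=
  ∃ F : Finset (Set X), F.card ≤ c ∧ A ⊆ ⋃ E ∈ F, E ∧ ∀ E ∈ F, E ⊆ A ∧ ∀ x ∈ E, ∀ y ∈ E, rel x y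

namespace HasCover

variable {X : Type*} {c c' : ℕ} {A B : Set X} {rel rel' : X → X → Prop}

lemma mono (h : HasCover c A rel) (hc : c ≤ c')
    (hrel : ∀ x ∈ A, ∀ y ∈ A, rel x y → rel' x y) : HasCover c' A rel' := by
  obtain ⟨F, h1, h2, h3⟩ := h
  exact ⟨F, h1.trans hc, h2, fun E hE => ⟨(h3 E hE).1, fun x hx y hy =>
    hrel x ((h3 E hE).1 hx) y ((h3 E hE).1 hy) ((h3 E hE).2 x hx y hy)⟩⟩

lemma subset (h : HasCover c A rel) (hB : B ⊆ A) : HasCover c B rel := by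
  classical
  obtain ⟨F, h1, h2, h3⟩ := h
  refine ⟨F.image (fun E => E ∩ B), Finset.card_image_le.trans h1, fun x hx => ?_, fun E hE => ?_⟩
  · obtain ⟨E, hE, hxE⟩ := Set.mem_iUnion₂.1 (h2 (hB hx))
    exact Set.mem_iUnion₂.2 ⟨E ∩ B, Finset.mem_image_of_mem _ hE, hxE, hx⟩
  · obtain ⟨E', hE', rfl⟩ := Finset.mem_image.1 hE
    exact ⟨Set.inter_subset_right, fun x hx y hy => (h3 E' hE').2 x hx.1 y hy.1⟩

lemma union (h : HasCover c A rel) (h' : HasCover c' B rel) : HasCover (c + c') (A ∪ B) rel := by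
  classical
  obtain ⟨F, h1, h2, h3⟩ := h
  obtain ⟨F', h1', h2', h3'⟩ := h'
  refine ⟨F ∪ F', (Finset.card_union_le _ _).trans (by gcongr), ?_, fun E hE => ?_⟩
  · refine Set.union_subset (h2.trans ?_) (h2'.trans ?_)
    · exact Set.biUnion_mono (fun E hE => Finset.mem_union_left _ hE) fun _ _ => subset_rfl
    · exact Set.biUnion_mono (fun E hE => Finset.mem_union_right _ hE) fun _ _ => subset_rfl
  · rcases Finset.mem_union.1 hE with hE | hE
    · exact ⟨(h3 E hE).1.trans Set.subset_union_left, (h3 E hE).2⟩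
    · exact ⟨(h3' E hE).1.trans Set.subset_union_right, (h3' E hE).2⟩

/-- Covers can be refined. -/
lemma bind (h : HasCover c A rel)
    (h' : ∀ E ⊆ A, (∀ x ∈ E, ∀ y ∈ E, rel x y) → HasCover c' E rel') :
    HasCover (c * c') A rel' := by
  classical
  obtain ⟨F, h1, h2, h3⟩ := h
  choose! G hG using fun E (hE : E ∈ F) => h' E (h3 E hE).1 (h3 E hE).2
  refine ⟨F.biUnion G, (Finset.card_biUnion_le_card_mul _ _ _ fun E hE => (hG E hE).1).trans
    (Nat.mul_le_mul_right _ h1), fun x hx => ?_, fun E' hE' => ?_⟩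
  · obtain ⟨E, hE, hxE⟩ := Set.mem_iUnion₂.1 (h2 hx)
    obtain ⟨E', hE', hxE'⟩ := Set.mem_iUnion₂.1 ((hG E hE).2.1 hxE)
    exact Set.mem_iUnion₂.2 ⟨E', Finset.mem_biUnion.2 ⟨E, hE, hE'⟩, hxE'⟩
  · obtain ⟨E, hE, hEE'⟩ := Finset.mem_biUnion.1 hE'
    exact ⟨((hG E hE).2.2 E' hEE').1.trans (h3 E hE).1, ((hG E hE).2.2 E' hEE').2⟩

lemma inter (h : HasCover c A rel) (h' : HasCover c' A rel') :
    HasCover (c * c') A fun x y => rel x y ∧ rel' x y := by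
  refine (h.bind (rel' := fun x y => rel x y ∧ rel' x y) fun E hE hrel => ?_)
  exact (h'.subset hE).mono le_rfl fun x hx y hy hxy => ⟨hrel x hx y hy, hxy⟩

lemma of_real {f : X → ℝ} {x₀ r ε : ℝ} {K : ℕ} (hε : 0 < ε) (hK : 2 * r ≤ K * ε)
    (hf : ∀ x ∈ A, |f x - x₀| ≤ r) : HasCover (K + 1) A fun x y => |f x - f y| ≤ ε := by
  classical
  refine ⟨(Finset.range (K + 1)).image fun k => {x ∈ A | ⌊(f x - (x₀ - r)) / ε⌋₊ = k},
    Finset.card_image_le.trans (by simp), fun x hx => ?_, fun E hE => ?_⟩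
  · refine Set.mem_iUnion₂.2 ⟨_, Finset.mem_image_of_mem _ (Finset.mem_range.2 ?_), hx, rfl⟩
    have := abs_le.1 (hf x hx)
    rw [Nat.lt_succ_iff]
    refine Nat.floor_le_of_le ?_
    rw [div_le_iff₀ hε]
    linarith
  · obtain ⟨k, -, rfl⟩ := Finset.mem_image.1 hE
    refine ⟨fun x hx => hx.1, fun x hx y hy => ?_⟩
    have key : ∀ z ∈ A, ⌊(f z - (x₀ - r)) / ε⌋₊ = k →
        k * ε ≤ f z - (x₀ - r) ∧ f z - (x₀ - r) < (k + 1) * ε := fun z hz hzk => by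
      have h0 : 0 ≤ f z - (x₀ - r) := by linarith [(abs_le.1 (hf z hz)).1]
      have h1 := (Nat.floor_eq_iff (div_nonneg h0 hε.le)).1 hzk
      rwa [le_div_iff₀ hε, div_lt_iff₀ hε] at h1
    have h1 := key x hx.1 hx.2
    have h2 := key y hy.1 hy.2
    refine abs_le.2 ⟨?_, ?_⟩ <;> linarith

lemma of_complex {f : X → ℂ} {x₀ : ℂ} {r ε : ℝ} {K : ℕ} (hε : 0 < ε) (hK : 2 * r ≤ K * ε)
    (hf : ∀ x ∈ A, ‖f x - x₀‖ ≤ r) :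
    HasCover ((K + 1) * (K + 1)) A fun x y => ‖f x - f y‖ ≤ 2 * ε := by
  have h1 : HasCover (K + 1) A fun x y => |(f x).re - (f y).re| ≤ ε :=
    of_real (x₀ := x₀.re) hε hK fun x hx => by
      rw [← Complex.sub_re]; exact (Complex.abs_re_le_norm _).trans (hf x hx)
  have h2 : HasCover (K + 1) A fun x y => |(f x).im - (f y).im| ≤ ε :=
    of_real (x₀ := x₀.im) hε hK fun x hx => by
      rw [← Complex.sub_im]; exact (Complex.abs_im_le_norm _).trans (hf x hx)
  refine (h1.inter h2).mono le_rfl fun x _ y _ h => ?_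
  have := Complex.norm_le_abs_re_add_abs_im (f x - f y)
  rw [Complex.sub_re, Complex.sub_im] at this
  linarith [h.1, h.2]

end HasCover

/-! ### The dynamics of frequencies under the inverse contractions -/

namespace ErdosKahane

variable {I : Type*}

/-- The sum of the exponents `β` of the first `n` letters of `e`. -/
def expSum (β : I → ℂ) (e : ℕ → I) (n : ℕ) : ℂ := ∑ j ∈ Finset.range n, β (e j)

/-- The frequency `x.1` after it has been expanded by the letters `e 0, …, e (n - 1)`, where the
letter `i` multiplies by `exp (x.2 * β i)`. -/
def orbit (β : I → ℂ) (e : ℕ → I) (n : ℕ) (x : ℂ × ℂ) : ℂ :=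
  x.1 * Complex.exp (x.2 * expSum β e n)

/-- The logarithmic parameters `w` for which all the expansion factors `exp (w * β i)` have modulus
between `a` and `b`, and `exp w` stays away from the real axis. -/
def admissible (β : I → ℂ) (a b η W : ℝ) : Set ℂ :=
  {w | ‖w‖ ≤ W ∧ η ≤ |(Complex.exp w).im| ∧
    ∀ i, a ≤ ‖Complex.exp (w * β i)‖ ∧ ‖Complex.exp (w * β i)‖ ≤ b}

/-- Pairs of a frequency of modulus at least one and an admissible parameter. -/
def phaseSpace (β : I → ℂ) (a b η W : ℝ) : Set (ℂ × ℂ) :=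
  {x | 1 ≤ ‖x.1‖ ∧ x.2 ∈ admissible β a b η W}

/-- At time `n` the expanded frequencies of `x` and `y` are `R`-close, and the parameters are
`R`-close relative to the size of the frequency. -/
def Close (β : I → ℂ) (e : ℕ → I) (n : ℕ) (R : ℝ) (x y : ℂ × ℂ) : Prop :=
  ‖orbit β e n x - orbit β e n y‖ ≤ R ∧ ‖x.2 - y.2‖ * ‖orbit β e n x‖ ≤ R

/-- The `m`-th block of length `L` of `e` contains four consecutive letters `i₁`. -/
def HasRun (L : ℕ) (i₁ : I) (e : ℕ → I) (m : ℕ) : Prop :=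
  ∃ j, m * L ≤ j ∧ j + 4 ≤ (m + 1) * L ∧ ∀ s < 4, e (j + s) = i₁

/-- The `m`-th block of length `L` contains a run of `i₁`, and at all its letters `i₁` the real part
of the expanded frequency is `ρ`-close to an integer. -/
def GoodBlock (L : ℕ) (ρ : ℝ) (i₁ : I) (β : I → ℂ) (e : ℕ → I) (x : ℂ × ℂ) (m : ℕ) : Prop :=
  HasRun L i₁ e m ∧ ∀ n, m * L ≤ n → n < (m + 1) * L → e n = i₁ →
    |(orbit β e (n + 1) x).re - round (orbit β e (n + 1) x).re| ≤ ρ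

open Classical in
/-- The number of blocks which are not good among the first `N` ones. -/
def badCount (L : ℕ) (ρ : ℝ) (i₁ : I) (β : I → ℂ) (e : ℕ → I) (N : ℕ) (x : ℂ × ℂ) : ℕ :=
  ((Finset.range N).filter fun m => ¬ GoodBlock L ρ i₁ β e x m).card

/-- The expansion constant of a block of length `L`, when the exponents are bounded by `Bm`. -/
def blockConst (b Bm : ℝ) (L : ℕ) : ℝ := b ^ L * (2 * L * Bm + 1)

variable {β : I → ℂ} {a b η W Bm R ρ : ℝ} {e : ℕ → I} {i₁ : I} {L : ℕ}

lemma norm_exp_expSum {w : ℂ} (n : ℕ) :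
    ‖Complex.exp (w * expSum β e n)‖ = ∏ j ∈ Finset.range n, ‖Complex.exp (w * β (e j))‖ := by
  rw [expSum, Finset.mul_sum, Complex.exp_sum, norm_prod]

lemma pow_le_norm_exp_expSum (ha : 0 ≤ a) {w : ℂ} (hw : w ∈ admissible β a b η W) (n : ℕ) :
    a ^ n ≤ ‖Complex.exp (w * expSum β e n)‖ := by
  rw [norm_exp_expSum]
  calc a ^ n = ∏ j ∈ Finset.range n, a := by simp
    _ ≤ _ := Finset.prod_le_prod (fun _ _ => ha) fun j _ => (hw.2.2 (e j)).1

lemma norm_exp_expSum_le {w : ℂ} (hw : w ∈ admissible β a b η W) (n : ℕ) :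
    ‖Complex.exp (w * expSum β e n)‖ ≤ b ^ n := by
  rw [norm_exp_expSum]
  calc _ ≤ ∏ j ∈ Finset.range n, b :=
        Finset.prod_le_prod (fun _ _ => norm_nonneg _) fun j _ => (hw.2.2 (e j)).2
    _ = b ^ n := by simp

lemma norm_expSum_le (hβ : ∀ i, ‖β i‖ ≤ Bm) (n : ℕ) : ‖expSum β e n‖ ≤ n * Bm := by
  refine (norm_sum_le _ _).trans ?_
  simpa using Finset.sum_le_sum fun j (_ : j ∈ Finset.range n) => hβ (e j)

lemma expSum_add (n k : ℕ) :
    expSum β e (n + k) = expSum β e n + expSum β (fun j => e (n + j)) k := by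
  rw [expSum, Finset.sum_range_add]; rfl

lemma orbit_add (n k : ℕ) (x : ℂ × ℂ) : orbit β e (n + k) x =
    orbit β e n x * Complex.exp (x.2 * expSum β (fun j => e (n + j)) k) := by
  rw [orbit, expSum_add, mul_add, Complex.exp_add, orbit]; ring

lemma pow_le_norm_orbit (ha : 0 ≤ a) {x : ℂ × ℂ} (hx : x ∈ phaseSpace β a b η W) (n : ℕ) :
    a ^ n ≤ ‖orbit β e n x‖ := by
  rw [orbit, norm_mul]
  exact (pow_le_norm_exp_expSum ha hx.2 n).trans (le_mul_of_one_le_left (norm_nonneg _) hx.1)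

lemma one_le_norm_orbit (ha : 1 ≤ a) {x : ℂ × ℂ} (hx : x ∈ phaseSpace β a b η W) (n : ℕ) :
    1 ≤ ‖orbit β e n x‖ :=
  (one_le_pow₀ ha).trans (pow_le_norm_orbit (zero_le_one.trans ha) hx n)

lemma norm_exp_sub_exp_le {u v : ℂ} (h : ‖u - v‖ ≤ 1) :
    ‖Complex.exp u - Complex.exp v‖ ≤ ‖Complex.exp v‖ * (2 * ‖u - v‖) := by
  have : Complex.exp u - Complex.exp v = Complex.exp v * (Complex.exp (u - v) - 1) := by
    rw [mul_sub, ← Complex.exp_add]; ring_nf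
  rw [this, norm_mul]
  gcongr
  exact Complex.norm_exp_sub_one_le h

lemma norm_sub_le_norm_exp_sub_exp {u v : ℂ} (h : ‖u - v‖ ≤ 1 / 2) (hv : 1 ≤ ‖Complex.exp v‖) :
    ‖u - v‖ ≤ 2 * ‖Complex.exp u - Complex.exp v‖ := by
  have h1 : Complex.exp u - Complex.exp v = Complex.exp v * (Complex.exp (u - v) - 1) := by
    rw [mul_sub, ← Complex.exp_add]; ring_nf
  have h2 := Complex.norm_exp_sub_one_sub_id_le (h.trans (by norm_num : (1 / 2 : ℝ) ≤ 1))
  have h3 : ‖u - v‖ ≤ ‖Complex.exp (u - v) - 1‖ + ‖Complex.exp (u - v) - 1 - (u - v)‖ := by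
    have := norm_sub_le (Complex.exp (u - v) - 1) (Complex.exp (u - v) - 1 - (u - v))
    rwa [sub_sub_cancel] at this
  have h4 : ‖Complex.exp (u - v) - 1‖ ≤ ‖Complex.exp u - Complex.exp v‖ := by
    rw [h1, norm_mul]; exact le_mul_of_one_le_left (norm_nonneg _) hv
  nlinarith [norm_nonneg (u - v)]

lemma one_le_blockConst (hb : 1 ≤ b) (hBm : 0 ≤ Bm) : 1 ≤ blockConst b Bm L := by
  have h1 : 1 ≤ b ^ L := one_le_pow₀ hb
  have h2 : 0 ≤ 2 * (L : ℝ) * Bm := by positivity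
  unfold blockConst
  nlinarith

lemma mul_le_blockConst (hb : 1 ≤ b) (hBm : 0 ≤ Bm) : L * Bm ≤ blockConst b Bm L := by
  have h1 : 1 ≤ b ^ L := one_le_pow₀ hb
  have h2 : 0 ≤ (L : ℝ) * Bm := by positivity
  unfold blockConst
  nlinarith

/-- Closeness deteriorates by at most the factor `blockConst` over `k ≤ L` steps. -/
lemma Close.add (ha : 1 ≤ a) (hb : 1 ≤ b) (hBm : 0 ≤ Bm) (hβ : ∀ i, ‖β i‖ ≤ Bm)
    {x y : ℂ × ℂ} (hx : x ∈ phaseSpace β a b η W) (hy : y ∈ phaseSpace β a b η W) {n k : ℕ}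
    (hk : k ≤ L) (hR : blockConst b Bm L * R ≤ 1) (h : Close β e n R x y) :
    Close β e (n + k) (blockConst b Bm L * R) x y := by
  have hR0 : 0 ≤ R := (norm_nonneg _).trans h.1
  have hkL : (k : ℝ) * Bm ≤ L * Bm := by gcongr
  have hbk : b ^ k ≤ b ^ L := pow_le_pow_right₀ hb hk
  have hbL : 1 ≤ b ^ L := one_le_pow₀ hb
  set S := expSum β (fun j => e (n + j)) k
  have hS : ‖S‖ ≤ L * Bm := (norm_expSum_le hβ k).trans hkL
  have hLB : 0 ≤ L * Bm := by positivity
  have hx1 := one_le_norm_orbit (e := e) ha hx n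
  have hw : ‖x.2 - y.2‖ ≤ R := (le_mul_of_one_le_right (norm_nonneg _) hx1).trans h.2
  have hex : ‖Complex.exp (x.2 * S)‖ ≤ b ^ L := (norm_exp_expSum_le hx.2 k).trans hbk
  have hey : ‖Complex.exp (y.2 * S)‖ ≤ b ^ L := (norm_exp_expSum_le hy.2 k).trans hbk
  constructor
  · rw [orbit_add, orbit_add]
    have h1 : orbit β e n x * Complex.exp (x.2 * S) - orbit β e n y * Complex.exp (y.2 * S) =
        orbit β e n x * (Complex.exp (x.2 * S) - Complex.exp (y.2 * S)) +
          (orbit β e n x - orbit β e n y) * Complex.exp (y.2 * S) := by ring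
    have h2 : ‖x.2 * S - y.2 * S‖ ≤ ‖x.2 - y.2‖ * (L * Bm) := by
      rw [← sub_mul, norm_mul]; gcongr
    have h3 : ‖x.2 * S - y.2 * S‖ ≤ 1 := by
      have := mul_le_mul_of_nonneg_right (mul_le_blockConst (L := L) hb hBm) hR0
      have := mul_le_mul_of_nonneg_right hw hLB
      linarith
    rw [h1]
    calc _ ≤ ‖orbit β e n x‖ * ‖Complex.exp (x.2 * S) - Complex.exp (y.2 * S)‖ +
          ‖orbit β e n x - orbit β e n y‖ * ‖Complex.exp (y.2 * S)‖ := by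
          rw [← norm_mul, ← norm_mul]; exact norm_add_le _ _
      _ ≤ ‖orbit β e n x‖ * (b ^ L * (2 * (‖x.2 - y.2‖ * (L * Bm)))) + R * b ^ L := by
          have := h.1
          have := (norm_exp_sub_exp_le h3).trans (mul_le_mul hey
            (mul_le_mul_of_nonneg_left h2 zero_le_two) (by positivity) (by positivity))
          gcongr
      _ = b ^ L * (2 * L * Bm) * (‖x.2 - y.2‖ * ‖orbit β e n x‖) + b ^ L * R := by ring
      _ ≤ b ^ L * (2 * L * Bm) * R + b ^ L * R := by
          have := h.2
          gcongr
      _ = _ := by rw [blockConst]; ring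
  · rw [orbit_add, norm_mul, ← mul_assoc]
    calc _ ≤ R * b ^ L := by
          have := h.2
          gcongr
      _ = b ^ L * (0 + 1) * R := by ring
      _ ≤ _ := by
          rw [blockConst]
          gcongr
          linarith

lemma abs_sub_le_of_round {u v ρ : ℝ} (hρ : ρ ≤ 1 / 8) (huv : |u - v| ≤ 1 / 4)
    (hu : |u - round u| ≤ ρ) (hv : |v - round v| ≤ ρ) : |u - v| ≤ 2 * ρ := by
  have h1 : round u = round v := by
    have h2 : |((round u - round v : ℤ) : ℝ)| < 1 := by
      push_cast
      rw [abs_le] at huv hu hv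
      rw [abs_lt]
      constructor <;> linarith
    have h3 : |round u - round v| < 1 := by exact_mod_cast h2
    rw [Int.abs_lt_one_iff] at h3
    linarith
  rw [h1] at hu
  rw [abs_le] at hu hv ⊢
  constructor <;> linarith

/-- Over a good block, closeness does not deteriorate: the nearest integers to the real parts of the
expanded frequencies are the same for both points, and these real parts determine the points. -/
lemma Close.of_goodBlock {C : ℝ} (hC : IsRecoveryConst b η C)
    (ha : 1 ≤ a) (hb : 1 ≤ b) (hBm : 0 ≤ Bm) (hβ : ∀ i, ‖β i‖ ≤ Bm) (hi₁ : β i₁ = 1)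
    (hR : blockConst b Bm L * R ≤ 1 / 4) (hRη : b * (2 * R) ≤ η) (hρ : ρ ≤ 1 / 8) (hρ0 : 0 ≤ ρ)
    (hρR : blockConst b Bm L * (4 * C * ρ) ≤ R)
    {x y : ℂ × ℂ} (hx : x ∈ phaseSpace β a b η W) (hy : y ∈ phaseSpace β a b η W) {m : ℕ}
    (h : Close β e (m * L) R x y) (hgx : GoodBlock L ρ i₁ β e x m)
    (hgy : GoodBlock L ρ i₁ β e y m) : Close β e ((m + 1) * L) R x y := by
  obtain ⟨hC1, hC⟩ := hC
  obtain ⟨⟨j, hj1, hj2, hj⟩, hgx⟩ := hgx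
  have hgy := hgy.2
  have hH : 1 ≤ blockConst b Bm L := one_le_blockConst hb hBm
  have hR0 : 0 ≤ R := (norm_nonneg _).trans h.1
  have hR4 : R ≤ 1 / 4 := (le_mul_of_one_le_left hR0 hH).trans hR
  have hmL : (m + 1) * L = m * L + L := by ring
  have hx1 := one_le_norm_orbit (e := e) ha hx (m * L)
  have hw : ‖x.2 - y.2‖ ≤ R := (le_mul_of_one_le_right (norm_nonneg _) hx1).trans h.2
  have hθ : ∀ {z : ℂ × ℂ}, z ∈ phaseSpace β a b η W →
      1 ≤ ‖Complex.exp z.2‖ ∧ ‖Complex.exp z.2‖ ≤ b := fun hz => by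
    have := hz.2.2.2 i₁
    rw [hi₁, mul_one] at this
    exact ⟨ha.trans this.1, this.2⟩
  have horb : ∀ z : ℂ × ℂ, ∀ s < 4,
      orbit β e (j + 1 + s) z = orbit β e (j + 1) z * Complex.exp z.2 ^ s := fun z s hs => by
    rw [orbit_add, ← Complex.exp_nat_mul]
    congr 2
    have : expSum β (fun t => e (j + 1 + t)) s = s := by
      rw [expSum, Finset.sum_congr rfl (g := fun _ => (1 : ℂ))]
      · simp
      · intro t ht
        have := Finset.mem_range.1 ht
        rw [show j + 1 + t = j + (t + 1) by ring, hj _ (by omega), hi₁]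
    rw [this, mul_comm]
  have hval : ∀ s < 4, |(orbit β e (j + 1) y * Complex.exp y.2 ^ s).re -
      (orbit β e (j + 1) x * Complex.exp x.2 ^ s).re| ≤ 2 * ρ := fun s hs => by
    have hpos : j + 1 + s = (j + s) + 1 := by ring
    rw [← horb x s hs, ← horb y s hs, abs_sub_comm, hpos]
    refine abs_sub_le_of_round hρ ?_ (hgx (j + s) (by omega) (by omega) (hj s hs))
      (hgy (j + s) (by omega) (by omega) (hj s hs))
    have h1 := (h.add ha hb hBm hβ hx hy (k := j + s + 1 - m * L) (L := L) (by omega)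
      (hR.trans (by norm_num))).1
    rw [show m * L + (j + s + 1 - m * L) = j + s + 1 by omega] at h1
    rw [← Complex.sub_re]
    exact (Complex.abs_re_le_norm _).trans (h1.trans hR)
  have hclose : ‖Complex.exp y.2 - Complex.exp x.2‖ ≤ η := by
    have h1 : ‖y.2 - x.2‖ ≤ R := by rwa [norm_sub_rev]
    refine (norm_exp_sub_exp_le (h1.trans (by linarith))).trans (le_trans ?_ hRη)
    have := (hθ hx).2
    gcongr
  have hZx := one_le_norm_orbit (e := e) ha hx (j + 1)
  obtain ⟨r1, r2⟩ := hC (orbit β e (j + 1) y) (Complex.exp y.2) (orbit β e (j + 1) x)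
    (Complex.exp x.2) (2 * ρ) (by positivity) (norm_pos_iff.1 (by linarith)) (hθ hy).2 (hθ hx).2
    hy.2.2.1 hx.2.2.1 hclose hval
  have hCρ : 0 ≤ C * ρ := by positivity
  have hnew : Close β e (j + 1) (4 * C * ρ) x y := by
    constructor
    · rw [norm_sub_rev]; linarith
    · have h1 := norm_sub_le_norm_exp_sub_exp (u := x.2) (v := y.2) (by linarith) (hθ hy).1
      rw [norm_sub_rev (Complex.exp _)] at h1
      have h2 := mul_le_mul_of_nonneg_right h1 (norm_nonneg (orbit β e (j + 1) x))
      linarith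
  have h3 := hnew.add ha hb hBm hβ hx hy (k := (m + 1) * L - (j + 1)) (L := L) (by omega)
    (hρR.trans (hR4.trans (by norm_num)))
  rw [show j + 1 + ((m + 1) * L - (j + 1)) = (m + 1) * L by omega] at h3
  exact ⟨h3.1.trans hρR, h3.2.trans hρR⟩

/-- The number of pieces into which a set is split over a block which is not good. -/
def splitConst (b Bm : ℝ) (L : ℕ) : ℕ := (⌈8 * blockConst b Bm L⌉₊ + 1) ^ 4

lemma hasCover_close_add (ha : 1 ≤ a) (hb : 1 ≤ b) (hBm : 0 ≤ Bm) (hβ : ∀ i, ‖β i‖ ≤ Bm)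
    (hR0 : 0 < R) (hR : blockConst b Bm L * R ≤ 1 / 4) {n : ℕ} {E : Set (ℂ × ℂ)}
    (hE : E ⊆ phaseSpace β a b η W) (hrel : ∀ x ∈ E, ∀ y ∈ E, Close β e n R x y) :
    HasCover (splitConst b Bm L) E (Close β e (n + L) R) := by
  rcases E.eq_empty_or_nonempty with rfl | ⟨x₀, hx₀⟩
  · exact ⟨∅, by simp, by simp, by simp⟩
  set H := blockConst b Bm L with hH
  set K := ⌈8 * H⌉₊ with hK
  have hKH : 8 * H ≤ K := Nat.le_ceil _
  have hs := one_le_norm_orbit (e := e) ha (hE hx₀) (n + L)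
  set s := ‖orbit β e (n + L) x₀‖ with hsdef
  have hstep : ∀ x ∈ E, ∀ y ∈ E, Close β e (n + L) (H * R) x y := fun x hx y hy =>
    (hrel x hx y hy).add ha hb hBm hβ (hE hx) (hE hy) le_rfl (hR.trans (by norm_num))
  have hε : 2 * (H * R) ≤ K * (R / 4) := by nlinarith
  have c1 := HasCover.of_complex (f := orbit β e (n + L)) (x₀ := orbit β e (n + L) x₀)
    (by positivity : 0 < R / 4) hε fun x hx => (hstep x hx x₀ hx₀).1
  have c2 := HasCover.of_complex (A := E) (f := fun x => (s : ℂ) * x.2) (x₀ := (s : ℂ) * x₀.2)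
    (by positivity : 0 < R / 4) hε fun x hx => by
      rw [← mul_sub, norm_mul, Complex.norm_real, Real.norm_eq_abs, abs_of_nonneg (by linarith),
        norm_sub_rev, mul_comm]
      exact (hstep x₀ hx₀ x hx).2
  refine (c1.inter c2).mono (by rw [splitConst, ← hH, ← hK]; apply le_of_eq; ring) ?_
  rintro x hx y - ⟨h1, h2⟩
  refine ⟨h1.trans (by linarith), ?_⟩
  rw [← mul_sub, norm_mul, Complex.norm_real, Real.norm_eq_abs, abs_of_nonneg (by linarith)] at h2
  have h3 : ‖orbit β e (n + L) x‖ ≤ 2 * s := by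
    have h4 := (hstep x hx x₀ hx₀).1
    have := norm_le_norm_add_norm_sub' (orbit β e (n + L) x) (orbit β e (n + L) x₀)
    linarith
  calc _ ≤ ‖x.2 - y.2‖ * (2 * s) := by gcongr
    _ ≤ R := by linarith

open Classical in
lemma badCount_succ (N : ℕ) (x : ℂ × ℂ) : badCount L ρ i₁ β e (N + 1) x =
    badCount L ρ i₁ β e N x + if GoodBlock L ρ i₁ β e x N then 0 else 1 := by
  rw [badCount, Finset.range_add_one, Finset.filter_insert]
  by_cases h : GoodBlock L ρ i₁ β e x N
  · rw [if_neg (not_not.2 h), if_pos h, badCount, add_zero]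
  · rw [if_pos h, if_neg h, Finset.card_insert_of_notMem (by simp), badCount]

/-- The counting step of the Erdős–Kahane argument: only the blocks which are not good increase the
number of pieces by more than the factor `2` accounting for their position. -/
lemma hasCover_badCount {C : ℝ} (hC : IsRecoveryConst b η C)
    (ha : 1 ≤ a) (hb : 1 ≤ b) (hBm : 0 ≤ Bm) (hβ : ∀ i, ‖β i‖ ≤ Bm) (hi₁ : β i₁ = 1)
    (hR0 : 0 < R) (hR : blockConst b Bm L * R ≤ 1 / 4) (hRη : b * (2 * R) ≤ η) (hρ : ρ ≤ 1 / 8)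
    (hρ0 : 0 ≤ ρ) (hρR : blockConst b Bm L * (4 * C * ρ) ≤ R)
    {A : Set (ℂ × ℂ)} (hA : A ⊆ phaseSpace β a b η W) {M₀ : ℕ}
    (hM₀ : HasCover M₀ A (Close β e 0 R)) (N k : ℕ) :
    HasCover (M₀ * 2 ^ N * splitConst b Bm L ^ k) {x ∈ A | badCount L ρ i₁ β e N x ≤ k}
      (Close β e (N * L) R) := by
  have hM : 1 ≤ splitConst b Bm L := Nat.one_le_pow _ _ (by omega)
  induction N generalizing k with
  | zero =>
    rw [zero_mul]
    exact (hM₀.subset (Set.sep_subset _ _)).mono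
      (by simpa using Nat.le_mul_of_pos_right M₀ (Nat.pow_pos hM)) fun _ _ _ _ h => h
  | succ N ih =>
    have hgood : HasCover (M₀ * 2 ^ N * splitConst b Bm L ^ k * 1)
        {x ∈ A | badCount L ρ i₁ β e N x ≤ k ∧ GoodBlock L ρ i₁ β e x N}
        (Close β e ((N + 1) * L) R) := by
      refine ((ih k).subset fun x hx => ⟨hx.1, hx.2.1⟩).bind fun E hE hrel =>
        ⟨{E}, by simp, by simp, ?_⟩
      simp only [Finset.mem_singleton, forall_eq]
      refine ⟨subset_rfl, fun x hx y hy => ?_⟩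
      exact (hrel x hx y hy).of_goodBlock hC ha hb hBm hβ hi₁ hR hRη hρ hρ0 hρR
        (hA (hE hx).1) (hA (hE hy).1) (hE hx).2.2 (hE hy).2.2
    rw [mul_one] at hgood
    cases k with
    | zero =>
      refine (hgood.subset fun x hx => ?_).mono ?_ fun _ _ _ _ h => h
      · have h := hx.2
        rw [badCount_succ] at h
        refine ⟨hx.1, by omega, ?_⟩
        by_contra hc
        rw [if_neg hc] at h
        omega
      · rw [pow_succ]; nlinarith [Nat.zero_le (M₀ * 2 ^ N * splitConst b Bm L ^ 0)]
    | succ k =>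
      have hbad : HasCover (M₀ * 2 ^ N * splitConst b Bm L ^ k * splitConst b Bm L)
          {x ∈ A | badCount L ρ i₁ β e N x ≤ k} (Close β e ((N + 1) * L) R) := by
        refine (ih k).bind fun E hE hrel => ?_
        rw [show (N + 1) * L = N * L + L by ring]
        exact hasCover_close_add ha hb hBm hβ hR0 hR (fun x hx => hA (hE hx).1) hrel
      refine ((hgood.union hbad).subset fun x hx => ?_).mono (le_of_eq (by ring))
        fun _ _ _ _ h => h
      have h := hx.2
      rw [badCount_succ] at h
      by_cases hc : GoodBlock L ρ i₁ β e x N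
      · rw [if_pos hc] at h
        exact Or.inl ⟨hx.1, by omega, hc⟩
      · rw [if_neg hc] at h
        exact Or.inr ⟨hx.1, by omega⟩

end ErdosKahane

/-! ### Hausdorff dimension of limsup sets -/

/-- A Borel–Cantelli type bound for the dimension of a limsup set. -/
lemma dimH_limsup_closure_le {A : ℕ → Set ℂ} {c : ℕ → ℕ} {R q α C r : ℝ} (hR : 0 ≤ R) (hq0 : 0 ≤ q)
    (hq1 : q < 1) (hα : 0 ≤ α) (hr0 : 0 ≤ r) (hr1 : r < 1) (hC : 0 ≤ C)
    (hcov : ∀ N, HasCover (c N) (A N) fun x y => ‖x - y‖ ≤ R * q ^ N)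
    (hc : ∀ N, c N * (R * q ^ N) ^ α ≤ C * r ^ N) :
    dimH {w | ∃ᶠ N in atTop, w ∈ closure (A N)} ≤ ENNReal.ofReal α := by
  choose F hF1 hF2 hF3 using hcov
  have hdiam : ∀ N, ∀ E ∈ F N, Metric.ediam (closure E) ≤ ENNReal.ofReal (R * q ^ N) :=
    fun N E hE => by
      rw [Metric.ediam_closure]
      refine Metric.ediam_le fun x hx y hy => ?_
      rw [edist_dist, dist_eq_norm]
      exact ENNReal.ofReal_le_ofReal ((hF3 N E hE).2 x hx y hy)
  set s := {w | ∃ᶠ N in atTop, w ∈ closure (A N)}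
  have hsum : Summable fun m : ℕ => C * r ^ m := (summable_geometric_of_lt_one hr0 hr1).mul_left C
  have key := Measure.hausdorffMeasure_le_liminf_tsum (β := ℕ)
    (ι := fun n => Σ m : ℕ, {E // E ∈ F (n + m)}) α s (l := atTop)
    (fun n => ENNReal.ofReal (R * q ^ n)) ?_ (fun n i => closure i.2.1) ?_ ?_
  · have hbound : ∀ n : ℕ, ∑' i : Σ m : ℕ, {E // E ∈ F (n + m)}, Metric.ediam (closure i.2.1) ^ α ≤
        ENNReal.ofReal (∑' m : ℕ, C * r ^ m) := fun n => by
      rw [ENNReal.tsum_sigma fun m (E : {E // E ∈ F (n + m)}) => Metric.ediam (closure E.1) ^ α,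
        ENNReal.ofReal_tsum_of_nonneg (fun m => by positivity) hsum]
      refine ENNReal.tsum_le_tsum fun m => ?_
      rw [tsum_fintype]
      calc ∑ E : {E // E ∈ F (n + m)}, Metric.ediam (closure E.1) ^ α
          ≤ ∑ E : {E // E ∈ F (n + m)}, ENNReal.ofReal ((R * q ^ (n + m)) ^ α) := by
            refine Finset.sum_le_sum fun E _ => ?_
            rw [← ENNReal.ofReal_rpow_of_nonneg (by positivity) hα]
            exact ENNReal.rpow_le_rpow (hdiam _ E.1 E.2) hα
        _ = ENNReal.ofReal ((F (n + m)).card * (R * q ^ (n + m)) ^ α) := by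
            rw [Finset.sum_const, Finset.card_univ, Fintype.card_coe, nsmul_eq_mul,
              ENNReal.ofReal_mul (by positivity), ENNReal.ofReal_natCast]
        _ ≤ ENNReal.ofReal (C * r ^ m) := by
            apply ENNReal.ofReal_le_ofReal
            have h1 : ((F (n + m)).card : ℝ) ≤ c (n + m) := by exact_mod_cast hF1 (n + m)
            have h2 : r ^ (n + m) ≤ r ^ m := pow_le_pow_of_le_one hr0 hr1.le (by omega)
            calc _ ≤ c (n + m) * (R * q ^ (n + m)) ^ α := by gcongr
              _ ≤ C * r ^ (n + m) := hc _
              _ ≤ _ := by gcongr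
    have hfin : Measure.hausdorffMeasure ((Real.toNNReal α : NNReal) : ℝ) s ≠ ⊤ := by
      rw [Real.coe_toNNReal α hα]
      refine ne_top_of_le_ne_top (b := ENNReal.ofReal (∑' m : ℕ, C * r ^ m))
        ENNReal.ofReal_ne_top (key.trans ?_)
      exact (liminf_le_liminf (Eventually.of_forall hbound)).trans (liminf_const _).le
    exact dimH_le_of_hausdorffMeasure_ne_top hfin
  · have : Tendsto (fun n : ℕ => R * q ^ n) atTop (𝓝 (R * 0)) :=
      (tendsto_pow_atTop_nhds_zero_of_lt_one hq0 hq1).const_mul R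
    simpa using ENNReal.tendsto_ofReal this
  · refine Eventually.of_forall fun n i => (hdiam _ _ i.2.2).trans ?_
    apply ENNReal.ofReal_le_ofReal
    gcongr R * ?_
    exact pow_le_pow_of_le_one hq0 hq1.le (by omega)
  · refine Eventually.of_forall fun n w hw => ?_
    obtain ⟨N, hN, hwN⟩ := (frequently_atTop.1 hw) n
    obtain ⟨m, rfl⟩ := Nat.exists_eq_add_of_le hN
    have h1 : closure (A (n + m)) ⊆ ⋃ E ∈ F (n + m), closure E := by
      refine closure_minimal ((hF2 _).trans ?_) ?_
      · exact Set.biUnion_mono subset_rfl fun E _ => subset_closure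
      · exact (F (n + m)).finite_toSet.isClosed_biUnion fun E _ => isClosed_closure
    obtain ⟨E, hE, hwE⟩ := Set.mem_iUnion₂.1 (h1 hwN)
    exact Set.mem_iUnion.2 ⟨⟨m, ⟨E, hE⟩⟩, hwE⟩

/-! ### Frequencies of blocks in Bernoulli sequences -/

section Bernoulli

variable {I : Type*} [Finite I] [MeasurableSpace I] [DiscreteMeasurableSpace I] (q : PMF I)

instance : IsProbabilityMeasure (bernoulliMeasure q) := by
  unfold bernoulliMeasure; infer_instance

/-- The strong law of large numbers for functions of disjoint blocks of length `L`. -/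
lemma ae_tendsto_block_average (L : ℕ) (g : (Fin L → I) → ℝ) :
    ∀ᵐ ω ∂(bernoulliMeasure q), Tendsto
      (fun N : ℕ => (∑ m ∈ Finset.range N, g fun s => ω (m * L + s)) / N) atTop
      (𝓝 (∫ ω, g (fun s => ω s) ∂(bernoulliMeasure q))) := by
  have hg : Measurable g := measurable_of_countable g
  have hmeas : ∀ m : ℕ, Measurable fun (ω : ℕ → I) (s : Fin L) => ω (m * L + s) := fun m =>
    measurable_pi_lambda _ fun s => measurable_pi_apply _
  have hlaw : ∀ m : ℕ, (bernoulliMeasure q).map (fun ω (s : Fin L) => ω (m * L + s)) =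
      Measure.infinitePi fun _ : Fin L => q.toMeasure := fun m =>
    Measure.map_infinitePi_infinitePi_of_inj (P := fun _ : ℕ => q.toMeasure)
      (f := fun s : Fin L => m * L + s) fun s t h => Fin.ext (Nat.add_left_cancel h)
  have h0 : (fun (ω : ℕ → I) (s : Fin L) => ω s) = fun ω s => ω (0 * L + s) := by
    funext ω s; rw [zero_mul, zero_add]
  have key := ProbabilityTheory.strong_law_ae_real (μ := bernoulliMeasure q)
    (fun m ω => g fun s => ω (m * L + s)) ?_ ?_ ?_
  · simp_rw [zero_mul, zero_add] at key
    exact key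
  · obtain ⟨B, hB⟩ := (Set.finite_range fun v => ‖g v‖).bddAbove
    exact Integrable.of_bound (hg.comp (hmeas 0)).aestronglyMeasurable B
      (Eventually.of_forall fun ω => hB ⟨_, rfl⟩)
  · intro m m' hmm
    have hind : ProbabilityTheory.iIndepFun (fun (n : ℕ) (ω : ℕ → I) => ω n) (bernoulliMeasure q) :=
      ProbabilityTheory.iIndepFun_infinitePi (P := fun _ : ℕ => q.toMeasure) (X := fun _ x => x)
        fun _ => measurable_id
    have hdisj : Disjoint (Finset.Ico (m * L) ((m + 1) * L))
        (Finset.Ico (m' * L) ((m' + 1) * L)) := by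
      rw [Finset.disjoint_left]
      intro n hn hn'
      rw [Finset.mem_Ico, add_mul, one_mul] at hn hn'
      rcases lt_or_gt_of_ne hmm with h | h
      · have := Nat.mul_le_mul_right L (Nat.succ_le_of_lt h); rw [Nat.succ_mul] at this; omega
      · have := Nat.mul_le_mul_right L (Nat.succ_le_of_lt h); rw [Nat.succ_mul] at this; omega
    have hmem : ∀ (k : ℕ) (s : Fin L), k * L + s ∈ Finset.Ico (k * L) ((k + 1) * L) :=
      fun k s => Finset.mem_Ico.2 ⟨by omega, by rw [add_mul]; omega⟩
    have hφ : ∀ k : ℕ, Measurable fun v : (Finset.Ico (k * L) ((k + 1) * L)) → I =>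
        g fun s => v ⟨k * L + s, hmem k s⟩ := fun k => measurable_of_countable _
    exact (hind.indepFun_finset _ _ hdisj fun n => measurable_pi_apply n).comp (hφ m) (hφ m')
  · intro m
    have : ProbabilityTheory.IdentDistrib (fun (ω : ℕ → I) (s : Fin L) => ω (m * L + s))
        (fun (ω : ℕ → I) (s : Fin L) => ω (0 * L + s)) (bernoulliMeasure q)
        (bernoulliMeasure q) :=
      ⟨(hmeas m).aemeasurable, (hmeas 0).aemeasurable, by rw [hlaw, hlaw]⟩
    exact this.comp hg

open ErdosKahane

/-- The words of length `L` containing four consecutive letters `i₁`. -/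
def runWords {I : Type*} (L : ℕ) (i₁ : I) : Set (Fin L → I) :=
  {v | ∃ (j : ℕ) (h : j + 4 ≤ L), ∀ s (hs : s < 4), v ⟨j + s, by omega⟩ = i₁}

lemma hasRun_iff {I : Type*} (L : ℕ) (i₁ : I) (ω : ℕ → I) (m : ℕ) :
    HasRun L i₁ ω m ↔ (fun s : Fin L => ω (m * L + s)) ∈ runWords L i₁ := by
  constructor
  · rintro ⟨j, h1, h2, h3⟩
    rw [add_mul, one_mul] at h2
    refine ⟨j - m * L, by omega, fun s hs => ?_⟩
    have h4 : m * L + (j - m * L + s) = j + s := by omega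
    exact (congrArg ω h4).trans (h3 s hs)
  · rintro ⟨j, h1, h2⟩
    refine ⟨m * L + j, by omega, by rw [add_mul, one_mul]; omega, fun s hs => ?_⟩
    rw [← h2 s hs, add_assoc]

variable {q} {i₁ : I}

lemma ae_exists_run (hq : 0 < q i₁) :
    ∀ᵐ ω ∂(bernoulliMeasure q), ∃ m : ℕ, HasRun 4 i₁ ω m := by
  classical
  set g : (Fin 4 → I) → ℝ := (runWords 4 i₁).indicator 1 with hg
  filter_upwards [ae_tendsto_block_average q 4 g] with ω hω
  by_contra! hno
  have h1 : ∀ m : ℕ, g (fun s => ω (m * 4 + s)) = 0 := fun m =>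
    Set.indicator_of_notMem (fun h => hno m ((hasRun_iff 4 i₁ ω m).2 h)) _
  simp only [h1, Finset.sum_const_zero, zero_div] at hω
  have h2 := tendsto_nhds_unique hω tendsto_const_nhds
  have h3 : ∫ ω, g (fun s => ω s) ∂(bernoulliMeasure q) =
      (bernoulliMeasure q).real ((fun (ω : ℕ → I) (s : Fin 4) => ω s) ⁻¹' runWords 4 i₁) := by
    rw [← integral_indicator_one]
    · rfl
    · exact (measurable_pi_lambda _ fun s => measurable_pi_apply _) (Set.toFinite _).measurableSet
  rw [h3, measureReal_eq_zero_iff] at h2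
  have h4 : Set.pi (Finset.range 4 : Set ℕ) (fun _ => {i₁}) ⊆
      (fun (ω : ℕ → I) (s : Fin 4) => ω s) ⁻¹' runWords 4 i₁ := fun ω' hω' =>
    ⟨0, le_rfl, fun s hs => by simpa using hω' s (by simpa using hs)⟩
  have h5 := measure_mono_null h4 h2
  rw [bernoulliMeasure, Measure.infinitePi_pi (fun _ : ℕ => q.toMeasure)
    (fun _ _ => measurableSet_singleton _), Finset.prod_const,
    PMF.toMeasure_apply_singleton _ _ (measurableSet_singleton _)] at h5
  exact hq.ne' (pow_eq_zero_iff (by simp) |>.1 h5)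

lemma measurableSet_not_hasRun (L : ℕ) (m : ℕ) : MeasurableSet {ω : ℕ → I | ¬ HasRun L i₁ ω m} := by
  simp_rw [hasRun_iff]
  exact (measurable_pi_lambda (fun (ω : ℕ → I) (s : Fin L) => ω (m * L + s))
    fun s => measurable_pi_apply _) (Set.toFinite (runWords L i₁)ᶜ).measurableSet

lemma _root_.ErdosKahane.HasRun.mono {I : Type*} {i₁ : I} {L L' : ℕ} {ω : ℕ → I} (h : HasRun L i₁ ω 0) (hL : L ≤ L') :
    HasRun L' i₁ ω 0 := by
  obtain ⟨j, h1, h2, h3⟩ := h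
  exact ⟨j, by omega, by omega, h3⟩

/-- Long blocks without a run of `i₁` are unlikely. -/
lemma tendsto_measureReal_not_hasRun (hq : 0 < q i₁) :
    Tendsto (fun L => (bernoulliMeasure q).real {ω | ¬ HasRun L i₁ ω 0}) atTop (𝓝 0) := by
  have h0 : bernoulliMeasure q (⋂ L, {ω | ¬ HasRun L i₁ ω 0}) = 0 := by
    refine measure_mono_null ?_ (ae_iff.1 (ae_exists_run hq))
    rintro ω hω ⟨m, j, h1, h2, h3⟩
    exact Set.mem_iInter.1 hω (j + 4) ⟨j, by omega, by omega, h3⟩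
  have h1 : Tendsto (fun L => bernoulliMeasure q {ω | ¬ HasRun L i₁ ω 0}) atTop (𝓝 0) := by
    rw [← h0]
    exact tendsto_measure_iInter_atTop (fun L => (measurableSet_not_hasRun L 0).nullMeasurableSet)
      (fun L L' h ω hω hc => hω (HasRun.mono hc h)) ⟨0, measure_ne_top _ _⟩
  exact (ENNReal.tendsto_toReal ENNReal.zero_ne_top).comp h1

open Classical in
/-- If `L` is large, then almost surely a small proportion of the blocks of length `L` contains no
run of `i₁`. -/
lemma eventually_ae_few_blocks_without_run (hq : 0 < q i₁) {ε : ℝ} (hε : 0 < ε) :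
    ∀ᶠ L : ℕ in atTop, ∀ᵐ ω ∂(bernoulliMeasure q), ∀ᶠ N : ℕ in atTop,
      (((Finset.range N).filter fun m => ¬ HasRun L i₁ ω m).card : ℝ) ≤ ε * N := by
  filter_upwards [(tendsto_measureReal_not_hasRun hq).eventually_lt_const hε] with L hL
  set g : (Fin L → I) → ℝ := (runWords L i₁)ᶜ.indicator 1 with hg
  have hgω : ∀ (ω : ℕ → I) (m : ℕ), g (fun s => ω (m * L + s)) =
      if ¬ HasRun L i₁ ω m then 1 else 0 := fun ω m => by
    simp only [hg, Set.indicator_apply, Set.mem_compl_iff, ← hasRun_iff, Pi.one_apply]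
  have hmean : ∫ ω, g (fun s => ω s) ∂(bernoulliMeasure q) =
      (bernoulliMeasure q).real {ω | ¬ HasRun L i₁ ω 0} := by
    rw [← integral_indicator_one (measurableSet_not_hasRun L 0)]
    refine integral_congr_ae (Eventually.of_forall fun ω => ?_)
    have := hgω ω 0
    simp only [zero_mul, zero_add] at this
    simp only [this, Set.indicator_apply, Set.mem_ofPred_eq, Pi.one_apply]
  filter_upwards [ae_tendsto_block_average q L g] with ω hω
  rw [hmean] at hω
  filter_upwards [hω.eventually_lt_const hL, eventually_gt_atTop 0] with N hN hN0
  rw [div_lt_iff₀ (by exact_mod_cast hN0)] at hN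
  refine le_of_eq_of_le ?_ hN.le
  simp_rw [hgω, Finset.sum_boole]

end Bernoulli

/-! ### Dimension of the set of resonant parameters -/

lemma HasCover.image {X Y : Type*} {c : ℕ} {A : Set X} {rel : X → X → Prop} {rel' : Y → Y → Prop}
    (h : HasCover c A rel) (f : X → Y) (hrel : ∀ x ∈ A, ∀ y ∈ A, rel x y → rel' (f x) (f y)) :
    HasCover c (f '' A) rel' := by
  classical
  obtain ⟨F, h1, h2, h3⟩ := h
  refine ⟨F.image (f '' ·), Finset.card_image_le.trans h1, ?_, fun E hE => ?_⟩
  · rintro _ ⟨x, hx, rfl⟩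
    obtain ⟨E, hE, hxE⟩ := Set.mem_iUnion₂.1 (h2 hx)
    exact Set.mem_iUnion₂.2 ⟨f '' E, Finset.mem_image_of_mem _ hE, x, hxE, rfl⟩
  · obtain ⟨E', hE', rfl⟩ := Finset.mem_image.1 hE
    refine ⟨Set.image_mono (h3 E' hE').1, ?_⟩
    rintro _ ⟨x, hx, rfl⟩ _ ⟨y, hy, rfl⟩
    exact hrel x ((h3 E' hE').1 hx) y ((h3 E' hE').1 hy) ((h3 E' hE').2 x hx y hy)

namespace ErdosKahane

variable {I : Type*}

/-- The admissible parameters for which some frequency of modulus in `[1, b ^ L]` has at most `δ N`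
blocks which are not good among the first `N` ones. -/
def resonantSet (a b η W : ℝ) (L : ℕ) (ρ δ : ℝ) (i₁ : I) (β : I → ℂ) (e : ℕ → I) (N : ℕ) : Set ℂ :=
  {w | w ∈ admissible β a b η W ∧
    ∃ z : ℂ, 1 ≤ ‖z‖ ∧ ‖z‖ ≤ b ^ L ∧ (badCount L ρ i₁ β e N (z, w) : ℝ) ≤ δ * N}

lemma hasCover_initial {β : I → ℂ} {a b η W R : ℝ} {L : ℕ} (hb : 1 ≤ b) (hR : 0 < R) :
    ∃ M₀, ∀ e, HasCover M₀ {x | x ∈ phaseSpace β a b η W ∧ ‖x.1‖ ≤ b ^ L} (Close β e 0 R) := by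
  have hD : 0 < b ^ L := by positivity
  set A := {x | x ∈ phaseSpace β a b η W ∧ ‖x.1‖ ≤ b ^ L}
  have hK : ∀ r ε : ℝ, 0 < ε → 2 * r ≤ (⌈2 * r / ε⌉₊ : ℝ) * ε := fun r ε hε => by
    rw [← div_le_iff₀ hε]; exact Nat.le_ceil _
  have c1 := HasCover.of_complex (A := A) (f := Prod.fst) (x₀ := 0) (half_pos hR)
    (hK (b ^ L) _ (half_pos hR)) fun x hx => by simpa using hx.2
  have hε : 0 < R / (2 * b ^ L) := by positivity
  have c2 := HasCover.of_complex (A := A) (f := Prod.snd) (x₀ := 0) hε (hK W _ hε)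
    fun x hx => by simpa using hx.1.2.1
  refine ⟨_, fun e => (c1.inter c2).mono le_rfl ?_⟩
  rintro x hx y - ⟨h1, h2⟩
  have h0 : ∀ z, orbit β e 0 z = z.1 := fun z => by simp [orbit, expSum]
  rw [Close, h0, h0]
  refine ⟨h1.trans_eq (by ring), ?_⟩
  calc _ ≤ 2 * (R / (2 * b ^ L)) * b ^ L := by
        gcongr
        exact hx.2
    _ = R := by field_simp

lemma eventually_splitConst_le {b Bm : ℝ} (hb : 1 < b) (hBm : 0 ≤ Bm) :
    ∀ᶠ L : ℕ in atTop, (splitConst b Bm L : ℝ) ≤ b ^ (8 * L) := by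
  have h1 := tendsto_pow_const_div_const_pow_of_one_lt 1 hb
  have h0 := tendsto_pow_const_div_const_pow_of_one_lt 0 hb
  have h2 := (h1.const_mul (20 * Bm)).add (h0.const_mul 10)
  simp only [mul_zero, add_zero] at h2
  filter_upwards [h2.eventually_lt_const one_pos] with L hL
  have hbL : 0 < b ^ L := by positivity
  have h3 : 10 * (2 * L * Bm + 1) ≤ b ^ L := by
    have h4 : (20 * Bm * ((L : ℝ) ^ 1 / b ^ L) + 10 * ((L : ℝ) ^ 0 / b ^ L)) * b ^ L =
        10 * (2 * L * Bm + 1) := by field_simp; ring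
    rw [← h4]
    exact mul_le_of_le_one_left hbL.le hL.le
  have hH := one_le_blockConst (L := L) hb.le hBm
  have h5 : ((⌈8 * blockConst b Bm L⌉₊ + 1 : ℕ) : ℝ) ≤ b ^ (2 * L) := by
    push_cast
    have h6 := Nat.ceil_lt_add_one (a := 8 * blockConst b Bm L) (by linarith)
    calc _ ≤ 10 * blockConst b Bm L := by linarith
      _ = b ^ L * (10 * (2 * L * Bm + 1)) := by rw [blockConst]; ring
      _ ≤ b ^ L * b ^ L := by gcongr
      _ = b ^ (2 * L) := by rw [← pow_add]; congr 1; ring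
  rw [splitConst, Nat.cast_pow]
  calc _ ≤ (b ^ (2 * L)) ^ 4 := by gcongr
    _ = _ := by rw [← pow_mul]; congr 1; ring

/-- The Erdős–Kahane argument: the parameters which are resonant infinitely often form a set of
dimension at most `α`, if the proportion `δ` of blocks allowed not to be good is small and the
blocks are long. -/
lemma exists_dimH_resonant_le {a b η α Bm : ℝ} (ha : 1 < a) (hb : 1 < b) (hη : 0 < η) (hα : 0 < α)
    (hBm : 0 ≤ Bm) : ∃ δ : ℝ, 0 < δ ∧ ∀ᶠ L : ℕ in atTop, ∃ ρ : ℝ, 0 < ρ ∧ ρ ≤ 1 / 8 ∧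
      ∀ (i₁ : I) (β : I → ℂ), β i₁ = 1 → (∀ i, ‖β i‖ ≤ Bm) → ∀ (W : ℝ) (e : ℕ → ℕ → I),
        dimH {w | ∃ᶠ N in atTop, w ∈ closure (resonantSet a b η W L ρ δ i₁ β (e N) N)} ≤
          ENNReal.ofReal α := by
  obtain ⟨C, hC⟩ := exists_isRecoveryConst b η hb.le hη
  have hC1 := hC.1
  have hla := Real.log_pos ha
  have hlb := Real.log_pos hb
  -- with this `δ` the number of covering sets of level `N` is at most
  -- `M₀ * 2 ^ N * a ^ (α * N * L / 2)`, as `splitConst` is at most `b ^ (8 * L)`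
  set δ := α * Real.log a / (16 * Real.log b) with hδ
  have hδ0 : 0 < δ := by positivity
  refine ⟨δ, hδ0, ?_⟩
  have hr : Tendsto (fun L : ℕ => 2 * Real.exp (-(α * Real.log a / 2 * L))) atTop (𝓝 (2 * 0)) := by
    refine Tendsto.const_mul 2 (Real.tendsto_exp_neg_atTop_nhds_zero.comp ?_)
    exact tendsto_natCast_atTop_atTop.const_mul_atTop (by positivity)
  rw [mul_zero] at hr
  filter_upwards [hr.eventually_lt_const one_pos, eventually_splitConst_le hb hBm,
    eventually_gt_atTop 0] with L hL1 hL2 hL0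
  set H := blockConst b Bm L with hH
  have hH1 : 1 ≤ H := one_le_blockConst hb.le hBm
  set R := min (1 / (4 * H)) (η / (2 * b)) with hRdef
  have hR0 : 0 < R := by positivity
  set ρ := min (1 / 8) (R / (4 * C * H)) with hρdef
  have hρ0 : 0 < ρ := by positivity
  refine ⟨ρ, hρ0, min_le_left _ _, fun i₁ β hi₁ hβ W e => ?_⟩
  have hHR : H * R ≤ 1 / 4 := by
    calc H * R ≤ H * (1 / (4 * H)) := by gcongr; exact min_le_left _ _
      _ = 1 / 4 := by field_simp
  have hRη : b * (2 * R) ≤ η := by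
    calc b * (2 * R) ≤ b * (2 * (η / (2 * b))) := by gcongr; exact min_le_right _ _
      _ = η := by field_simp
  have hρR : H * (4 * C * ρ) ≤ R := by
    calc H * (4 * C * ρ) ≤ H * (4 * C * (R / (4 * C * H))) := by gcongr; exact min_le_right _ _
      _ = R := by field_simp
  obtain ⟨M₀, hM₀⟩ := hasCover_initial (β := β) (a := a) (η := η) (W := W) (L := L) hb.le hR0
  have haL : 1 < a ^ L := one_lt_pow₀ ha hL0.ne'
  refine dimH_limsup_closure_le (c := fun N => M₀ * 2 ^ N * splitConst b Bm L ^ ⌊δ * N⌋₊)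
    (q := (a ^ L)⁻¹) (C := M₀ * R ^ α) hR0.le (by positivity) (inv_lt_one_of_one_lt₀ haL) hα.le
    (r := 2 * Real.exp (-(α * Real.log a / 2 * L))) (by positivity) hL1 (by positivity)
    (fun N => ?_) fun N => ?_
  · have h1 := hasCover_badCount hC ha.le hb.le hBm hβ hi₁ hR0 hHR hRη (min_le_left _ _) hρ0.le
      hρR (fun x hx => hx.1) (hM₀ (e N)) N ⌊δ * N⌋₊
    refine (h1.image Prod.snd (rel' := fun x y => ‖x - y‖ ≤ R * (a ^ L)⁻¹ ^ N) ?_).subset ?_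
    · rintro x hx y - h
      have h2 := pow_le_norm_orbit (e := e N) (zero_le_one.trans ha.le) hx.1.1 (N * L)
      rw [inv_pow, ← pow_mul, mul_comm L, ← div_eq_mul_inv, le_div_iff₀ (by positivity)]
      exact (mul_le_mul_of_nonneg_left h2 (norm_nonneg _)).trans h.2
    · rintro w ⟨hw, z, hz1, hz2, hz3⟩
      exact ⟨(z, w), ⟨⟨⟨hz1, hw⟩, hz2⟩, Nat.le_floor hz3⟩, rfl⟩
  · have hM1 : (1 : ℝ) ≤ splitConst b Bm L := by
      exact_mod_cast Nat.one_le_pow _ _ (by omega)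
    have h1 : (splitConst b Bm L : ℝ) ^ ⌊δ * N⌋₊ ≤ Real.exp (α * Real.log a / 2 * L * N) := by
      rw [← Real.rpow_natCast]
      calc _ ≤ (splitConst b Bm L : ℝ) ^ (δ * N) :=
            Real.rpow_le_rpow_of_exponent_le hM1 (Nat.floor_le (by positivity))
        _ ≤ (b ^ (8 * L)) ^ (δ * N) := by gcongr
        _ = Real.exp (α * Real.log a / 2 * L * N) := by
            rw [Real.rpow_def_of_pos (by positivity), Real.log_pow, hδ]
            congr 1
            push_cast
            field_simp
            ring
    have h2 : (R * (a ^ L)⁻¹ ^ N) ^ α = R ^ α * Real.exp (-(α * Real.log a * L * N)) := by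
      rw [Real.mul_rpow hR0.le (by positivity)]
      congr 1
      rw [Real.rpow_def_of_pos (by positivity), Real.log_pow, Real.log_inv, Real.log_pow]
      congr 1
      ring
    push_cast
    rw [h2]
    calc _ ≤ M₀ * 2 ^ N * Real.exp (α * Real.log a / 2 * L * N) *
          (R ^ α * Real.exp (-(α * Real.log a * L * N))) := by gcongr
      _ = M₀ * R ^ α * (2 ^ N * (Real.exp (α * Real.log a / 2 * L * N) *
          Real.exp (-(α * Real.log a * L * N)))) := by ring
      _ = _ := by
          rw [mul_pow, ← Real.exp_add, ← Real.exp_nat_mul]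
          congr 3
          ring

/-! ### Fourier decay at non-resonant parameters -/

/-- The first `N * L` letters of `ω` in reverse order. (Letters beyond this are junk.) -/
def reversed (L N : ℕ) (ω : ℕ → I) (n : ℕ) : I := ω (N * L - 1 - n)

lemma expSum_reversed {β : I → ℂ} {L N : ℕ} {ω : ℕ → I} {k : ℕ} (hk : k ≤ N * L) :
    expSum β (reversed L N ω) k = expSum β ω (N * L) - expSum β ω (N * L - k) := by
  induction k with
  | zero => simp [expSum]
  | succ k ih =>
    have h1 : N * L - k = (N * L - 1 - k) + 1 := by omega
    have h2 : N * L - (k + 1) = N * L - 1 - k := by omega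
    rw [expSum, Finset.sum_range_succ, ← expSum, ih (by omega), h1, h2]
    simp only [expSum, Finset.sum_range_succ, reversed]
    ring

lemma hasRun_reversed {i₁ : I} {L N m : ℕ} {ω : ℕ → I} (hm : m < N)
    (h : HasRun L i₁ ω (N - 1 - m)) : HasRun L i₁ (reversed L N ω) m := by
  obtain ⟨r, rfl⟩ := Nat.exists_eq_add_of_lt hm
  rw [show m + r + 1 - 1 - m = r by omega] at h
  obtain ⟨j, h1, h2, h3⟩ := h
  have e1 : (m + r + 1) * L = m * L + r * L + L := by ring
  have e2 : (r + 1) * L = r * L + L := by ring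
  have e3 : (m + 1) * L = m * L + L := by ring
  refine ⟨m * L + r * L + L - 4 - j, by omega, by omega, fun s hs => ?_⟩
  rw [reversed, e1, ← h3 (3 - s) (by omega)]
  congr 1
  omega

open Classical in
lemma badCount_le {L : ℕ} {ρ : ℝ} {i₁ : I} {β : I → ℂ} {N : ℕ} {ω : ℕ → I} {x : ℂ × ℂ} :
    badCount L ρ i₁ β (reversed L N ω) N x ≤
      ((Finset.range N).filter fun m => HasRun L i₁ (reversed L N ω) m ∧
        ¬ GoodBlock L ρ i₁ β (reversed L N ω) x m).card +
      ((Finset.range N).filter fun m => ¬ HasRun L i₁ ω m).card := by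
  refine (Finset.card_le_card (t := ((Finset.range N).filter fun m =>
    HasRun L i₁ (reversed L N ω) m ∧ ¬ GoodBlock L ρ i₁ β (reversed L N ω) x m) ∪
    ((Finset.range N).filter fun m => ¬ HasRun L i₁ ω m).image (fun m => N - 1 - m)) ?_).trans
    ((Finset.card_union_le _ _).trans (Nat.add_le_add_left Finset.card_image_le _))
  intro m hm
  rw [Finset.mem_filter, Finset.mem_range] at hm
  rw [Finset.mem_union, Finset.mem_filter, Finset.mem_image, Finset.mem_range]
  by_cases h : HasRun L i₁ (reversed L N ω) m
  · exact Or.inl ⟨hm.1, h, hm.2⟩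
  · refine Or.inr ⟨N - 1 - m, ?_, by omega⟩
    rw [Finset.mem_filter, Finset.mem_range]
    exact ⟨by omega, fun hc => h (hasRun_reversed hm.1 hc)⟩

end ErdosKahane

namespace ErdosKahane

variable {I : Type*} [Finite I] [MeasurableSpace I]

/-- An upper bound, in `(0, 1)`, for a factor of the Fourier transform at a letter with two
different translations of weight at least `pm`, when the phase difference is `ρ`-far from the
integers. -/
def gain (pm ρ : ℝ) : ℝ := 1 - 2 * min pm (1 / 2) * (1 - Real.cos (Real.pi * ρ))

lemma cos_pi_mul_mem {ρ : ℝ} (h0 : 0 < ρ) (h1 : ρ ≤ 1 / 8) :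
    0 < Real.cos (Real.pi * ρ) ∧ Real.cos (Real.pi * ρ) < 1 := by
  have hπ := Real.pi_pos
  constructor
  · apply Real.cos_pos_of_mem_Ioo
    constructor <;> nlinarith
  · rw [← Real.cos_zero]
    exact Real.cos_lt_cos_of_nonneg_of_le_pi le_rfl (by nlinarith) (by positivity)

lemma gain_pos {pm ρ : ℝ} (h0 : 0 < ρ) (h1 : ρ ≤ 1 / 8) : 0 < gain pm ρ := by
  have := cos_pi_mul_mem h0 h1
  have := min_le_right pm (1 / 2)
  unfold gain
  nlinarith

lemma gain_lt_one {pm ρ : ℝ} (hpm : 0 < pm) (h0 : 0 < ρ) (h1 : ρ ≤ 1 / 8) : gain pm ρ < 1 := by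
  have h2 := cos_pi_mul_mem h0 h1
  have h3 : 0 < min pm (1 / 2) := by positivity
  have : 0 < 2 * min pm (1 / 2) * (1 - Real.cos (Real.pi * ρ)) :=
    mul_pos (by positivity) (by linarith)
  unfold gain
  linarith

/-- The exponent of Fourier decay: it is chosen such that `(b ^ L) ^ (-σ) = (gain pm ρ) ^ (δ / 2)`,
where `b ^ L` bounds the expansion over a block. -/
def decayExponent (b : ℝ) (L : ℕ) (ρ δ pm : ℝ) : ℝ :=
  -(δ / 2 * Real.log (gain pm ρ)) / (L * Real.log b)

lemma decayExponent_pos {b ρ δ pm : ℝ} {L : ℕ} (hb : 1 < b) (hL : 0 < L) (hρ0 : 0 < ρ)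
    (hρ : ρ ≤ 1 / 8) (hδ : 0 < δ) (hpm : 0 < pm) : 0 < decayExponent b L ρ δ pm := by
  have h1 := Real.log_neg (gain_pos (pm := pm) hρ0 hρ) (gain_lt_one hpm hρ0 hρ)
  have h2 := Real.log_pos hb
  have h3 : (0 : ℝ) < L := by exact_mod_cast hL
  refine div_pos ?_ (by positivity)
  have : δ / 2 * Real.log (gain pm ρ) < 0 := mul_neg_of_pos_of_neg (by positivity) h1
  linarith

lemma rpow_neg_decayExponent {b ρ δ pm : ℝ} {L : ℕ} (hb : 1 < b) (hL : 0 < L) (hρ0 : 0 < ρ)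
    (hρ : ρ ≤ 1 / 8) : (b ^ L) ^ (-decayExponent b L ρ δ pm) = gain pm ρ ^ (δ / 2) := by
  have h2 := Real.log_pos hb
  have h3 : (0 : ℝ) < L := by exact_mod_cast hL
  rw [Real.rpow_def_of_pos (by positivity), Real.rpow_def_of_pos (gain_pos hρ0 hρ), Real.log_pow,
    decayExponent]
  congr 1
  field_simp

variable {M : PlanarModel I} {a b η W ρ δ pm : ℝ} {L : ℕ} {i₁ : I} {β : I → ℂ} {w : ℂ} {ω : ℕ → I}

lemma prod_lam (hlam : ∀ i, M.lam i = Complex.exp (-(w * β i))) (n : ℕ) :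
    ∏ j ∈ Finset.range n, M.lam (ω j) = Complex.exp (-(w * expSum β ω n)) := by
  rw [Finset.prod_congr rfl fun j _ => hlam (ω j), ← Complex.exp_sum, expSum, Finset.mul_sum,
    Finset.sum_neg_distrib]

open Classical in
/-- The product formula for the Fourier transform gains a factor `gain pm ρ` for every block which
contains a run of `i₁` but is not good, where time is reversed: the orbit starts at the frequency
`z` into which `(t i₁ j - t i₁ j') * conj ξ` is contracted by the first `N * L` letters. -/
lemma norm_planarFourier_le_gain_pow (hlam : ∀ i, M.lam i = Complex.exp (-(w * β i)))
    {j j' : Fin (M.k i₁)} (hjj : j ≠ j') (hpm : 0 < pm)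
    (hj : pm ≤ (M.p i₁ j).toReal) (hj' : pm ≤ (M.p i₁ j').toReal) (hρ0 : 0 < ρ) (hρ : ρ ≤ 1 / 8)
    (ξ : ℂ) (N : ℕ) {z : ℂ}
    (hz : z = (M.t i₁ j - M.t i₁ j') * starRingEnd ℂ ξ *
      ∏ n ∈ Finset.range (N * L), M.lam (ω n)) {K : ℕ}
    (hK : K + ((Finset.range N).filter fun m => ¬ HasRun L i₁ ω m).card <
      badCount L ρ i₁ β (reversed L N ω) N (z, w)) :
    ‖planarFourier (M.randomMeasure ω) ξ‖ ≤ gain pm ρ ^ K := by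
  set e := reversed L N ω with he
  set f : ℕ → ℝ := fun n => ‖M.letterFourier (ω n)
    ((∏ j ∈ Finset.range n, M.lam (ω j)) * starRingEnd ℂ ξ)‖ with hf
  set T := (Finset.range (N * L)).filter fun n => f n ≤ gain pm ρ with hT
  set B := (Finset.range N).filter fun m => HasRun L i₁ e m ∧
    ¬ GoodBlock L ρ i₁ β e (z, w) m with hB
  have hκ0 := gain_pos (pm := pm) hρ0 hρ
  have hκ1 := gain_lt_one hpm hρ0 hρ
  -- the frequency seen by the letter `N * L - 1 - n` of `ω`
  have horbit : ∀ n < N * L, orbit β e (n + 1) (z, w) = (M.t i₁ j - M.t i₁ j') *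
      ((∏ j ∈ Finset.range (N * L - 1 - n), M.lam (ω j)) * starRingEnd ℂ ξ) := fun n hn => by
    rw [orbit, hz, prod_lam hlam, prod_lam hlam, he, expSum_reversed (by omega),
      show N * L - (n + 1) = N * L - 1 - n by omega]
    have : ∀ u v : ℂ, Complex.exp (-(w * v)) =
        Complex.exp (-(w * u)) * Complex.exp (w * (u - v)) := fun u v => by
      rw [← Complex.exp_add]; ring_nf
    rw [this (expSum β ω (N * L)) (expSum β ω (N * L - 1 - n))]
    ring
  have hsub : B ⊆ T.image fun n => (N * L - 1 - n) / L := by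
    intro m hm
    rw [hB, Finset.mem_filter, Finset.mem_range] at hm
    obtain ⟨hmN, hrun, hgood⟩ := hm
    have hmL : (m + 1) * L ≤ N * L := Nat.mul_le_mul_right L hmN
    rw [GoodBlock, not_and] at hgood
    have := hgood hrun
    push Not at this
    obtain ⟨n, hn1, hn2, hn3, hn4⟩ := this
    refine Finset.mem_image.2 ⟨N * L - 1 - n, ?_, ?_⟩
    · rw [hT, Finset.mem_filter, Finset.mem_range]
      refine ⟨by omega, ?_⟩
      have hωn : ω (N * L - 1 - n) = i₁ := hn3
      rw [hf]
      simp only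
      rw [hωn]
      rw [horbit n (by omega)] at hn4
      exact M.norm_letterFourier_le i₁ _ hjj (by positivity) ((min_le_left _ _).trans hj)
        ((min_le_left _ _).trans hj') hρ0.le hn4.le
    · rw [show N * L - 1 - (N * L - 1 - n) = n by omega]
      exact Nat.div_eq_of_lt_le hn1 hn2
  have hKT : K ≤ T.card := by
    have h1 : B.card ≤ T.card := (Finset.card_le_card hsub).trans Finset.card_image_le
    have h2 := badCount_le (L := L) (ρ := ρ) (i₁ := i₁) (β := β) (N := N) (ω := ω) (x := (z, w))
    rw [← he, ← hB] at h2
    omega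
  calc ‖planarFourier (M.randomMeasure ω) ξ‖ ≤ ∏ n ∈ Finset.range (N * L), f n :=
        M.norm_planarFourier_randomMeasure_le ω ξ (N * L)
    _ ≤ ∏ n ∈ T, f n := Finset.prod_le_prod_of_subset_of_le_one (Finset.filter_subset _ _)
        (fun _ _ => norm_nonneg _) (fun n _ _ => M.norm_letterFourier_le_one _ _)
    _ ≤ ∏ n ∈ T, gain pm ρ := Finset.prod_le_prod (fun _ _ => norm_nonneg _)
        fun n hn => (Finset.mem_filter.1 hn).2
    _ = gain pm ρ ^ T.card := by rw [Finset.prod_const]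
    _ ≤ gain pm ρ ^ K := pow_le_pow_of_le_one hκ0.le hκ1.le hKT

/-- Every large frequency is contracted into the annulus `1 ≤ ‖z‖ ≤ b ^ L` by the first `N` blocks,
for some `N`. -/
lemma exists_contracted (ha : 1 < a) (hL : 0 < L) (hlam : ∀ i, M.lam i = Complex.exp (-(w * β i)))
    (hw : w ∈ admissible β a b η W) {ζ : ℂ} (hζ : 1 ≤ ‖ζ‖) :
    ∃ N : ℕ, 1 ≤ ‖ζ * ∏ n ∈ Finset.range (N * L), M.lam (ω n)‖ ∧
      ‖ζ * ∏ n ∈ Finset.range (N * L), M.lam (ω n)‖ ≤ b ^ L ∧ ‖ζ‖ ≤ (b ^ L) ^ (N + 1) := by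
  classical
  have ha0 : 0 ≤ a := by linarith
  have hnorm : ∀ i, ‖M.lam i‖ = ‖Complex.exp (w * β i)‖⁻¹ := fun i => by
    rw [hlam, Complex.exp_neg, norm_inv]
  have hlow : ∀ i, b⁻¹ ≤ ‖M.lam i‖ := fun i => by
    rw [hnorm]
    exact inv_anti₀ (by linarith [(hw.2.2 i).1]) (hw.2.2 i).2
  have hup : ∀ i, ‖M.lam i‖ ≤ a⁻¹ := fun i => by
    rw [hnorm]
    exact inv_anti₀ (by linarith) (hw.2.2 i).1
  have hb : 0 < b := by linarith [(hw.2.2 (ω 0)).1, (hw.2.2 (ω 0)).2]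
  have hex : ∃ N : ℕ, ‖ζ * ∏ n ∈ Finset.range (N * L), M.lam (ω n)‖ < 1 := by
    have haL : (a ^ L)⁻¹ < 1 := inv_lt_one_of_one_lt₀ (one_lt_pow₀ ha hL.ne')
    have h1 := (tendsto_pow_atTop_nhds_zero_of_lt_one (by positivity) haL).const_mul ‖ζ‖
    rw [mul_zero] at h1
    obtain ⟨N, hN⟩ := (h1.eventually_lt_const one_pos).exists
    refine ⟨N, lt_of_le_of_lt ?_ hN⟩
    rw [norm_mul, norm_prod]
    gcongr
    calc _ ≤ ∏ n ∈ Finset.range (N * L), a⁻¹ :=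
          Finset.prod_le_prod (fun _ _ => norm_nonneg _) fun n _ => hup _
      _ = _ := by rw [Finset.prod_const, Finset.card_range, inv_pow, inv_pow, ← pow_mul, mul_comm]
  have h0 : Nat.find hex ≠ 0 := fun h => by
    have := Nat.find_spec hex
    rw [h] at this
    simp at this
    linarith
  obtain ⟨N, hN⟩ := Nat.exists_eq_succ_of_ne_zero h0
  have h1 : ‖ζ * ∏ n ∈ Finset.range ((N + 1) * L), M.lam (ω n)‖ < 1 := by
    have := Nat.find_spec hex
    rwa [hN] at this
  have h2 : 1 ≤ ‖ζ * ∏ n ∈ Finset.range (N * L), M.lam (ω n)‖ :=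
    not_lt.1 (Nat.find_min hex (by omega))
  have hprod : ∀ (g : ℕ → I) (n : ℕ), (b ^ n)⁻¹ ≤ ∏ k ∈ Finset.range n, ‖M.lam (g k)‖ :=
    fun g n => by
      calc (b ^ n)⁻¹ = ∏ k ∈ Finset.range n, b⁻¹ := by simp
        _ ≤ _ := Finset.prod_le_prod (fun _ _ => by positivity) fun n _ => hlow _
  have h3 : ‖ζ * ∏ n ∈ Finset.range (N * L), M.lam (ω n)‖ ≤ b ^ L := by
    have h4 : (N + 1) * L = N * L + L := by ring
    rw [h4, Finset.prod_range_add, ← mul_assoc, norm_mul, norm_prod (Finset.range L)] at h1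
    have h5 := mul_le_mul_of_nonneg_left (hprod (fun k => ω (N * L + k)) L)
      (norm_nonneg (ζ * ∏ n ∈ Finset.range (N * L), M.lam (ω n)))
    have h6 := h5.trans h1.le
    rw [← div_eq_mul_inv, div_le_one (by positivity)] at h6
    exact h6
  refine ⟨N, h2, h3, ?_⟩
  have h7 := mul_le_mul_of_nonneg_left (hprod ω (N * L)) (norm_nonneg ζ)
  rw [norm_mul, norm_prod] at h3
  have h8 := h7.trans h3
  rw [← div_eq_mul_inv, div_le_iff₀ (by positivity)] at h8
  refine h8.trans_eq ?_
  rw [← pow_add, ← pow_mul]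
  congr 1
  ring

lemma norm_planarFourier_le_one (M : PlanarModel I) (ω : ℕ → I) (ξ : ℂ) :
    ‖planarFourier (M.randomMeasure ω) ξ‖ ≤ 1 := by
  simpa using M.norm_planarFourier_randomMeasure_le ω ξ 0

open Classical in
/-- Power Fourier decay at the parameters which are resonant finitely often, for sequences with few
blocks without a run of `i₁`. -/
lemma randomMeasure_mem_fourierDecayClass (ha : 1 < a) (hL : 0 < L) (hρ0 : 0 < ρ) (hρ : ρ ≤ 1 / 8)
    (hδ : 0 < δ) (hpm : 0 < pm) (hw : w ∈ admissible β a b η W)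
    (hlam : ∀ i, M.lam i = Complex.exp (-(w * β i))) {j j' : Fin (M.k i₁)}
    (ht : M.t i₁ j ≠ M.t i₁ j') (hj : pm ≤ (M.p i₁ j).toReal) (hj' : pm ≤ (M.p i₁ j').toReal)
    (hω : ∀ᶠ N : ℕ in atTop,
      (((Finset.range N).filter fun m => ¬ HasRun L i₁ ω m).card : ℝ) ≤ δ / 2 * N)
    (hres : ∀ᶠ N : ℕ in atTop, w ∉ resonantSet a b η W L ρ δ i₁ β (reversed L N ω) N) :
    M.randomMeasure ω ∈ FourierDecayClass (decayExponent b L ρ δ pm) := by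
  refine ⟨M.isProbabilityMeasure_randomMeasure ω, ?_⟩
  have hb : 1 < b := lt_of_lt_of_le ha ((hw.2.2 i₁).1.trans (hw.2.2 i₁).2)
  have hκ0 := gain_pos (pm := pm) hρ0 hρ
  have hκ1 := gain_lt_one hpm hρ0 hρ
  have hσ0 := decayExponent_pos hb hL hρ0 hρ hδ hpm
  have hσ := rpow_neg_decayExponent (δ := δ) (pm := pm) hb hL hρ0 hρ
  set σ := decayExponent b L ρ δ pm
  set κ := gain pm ρ
  set D := b ^ L with hD
  have hD1 : 1 < D := one_lt_pow₀ hb hL.ne'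
  obtain ⟨N₀, hN₀⟩ := eventually_atTop.1 (hω.and hres)
  set τ := M.t i₁ j - M.t i₁ j' with hτ
  have hτ0 : 0 < ‖τ‖ := norm_pos_iff.2 (sub_ne_zero.2 ht)
  set C := max ((D ^ (N₀ + 1)) ^ σ) (κ ^ (-(δ / 2 + 1))) with hC
  have hC0 : 0 ≤ C := le_max_of_le_left (by positivity)
  refine ⟨C * ‖τ‖ ^ (-σ), fun ξ hξ => ?_⟩
  have hξ0 : 0 < ‖ξ‖ := norm_pos_iff.2 hξ
  set ζ := τ * starRingEnd ℂ ξ with hζ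
  have hζn : ‖ζ‖ = ‖τ‖ * ‖ξ‖ := by rw [hζ, norm_mul, RCLike.norm_conj]
  have hζ0 : 0 < ‖ζ‖ := by rw [hζn]; positivity
  rw [mul_assoc, ← Real.mul_rpow hτ0.le hξ0.le, ← hζn]
  rcases le_or_gt ‖ζ‖ (D ^ (N₀ + 1)) with hsmall | hlarge
  · calc _ ≤ 1 := norm_planarFourier_le_one M ω ξ
      _ = ‖ζ‖ ^ σ * ‖ζ‖ ^ (-σ) := by rw [← Real.rpow_add hζ0, add_neg_cancel, Real.rpow_zero]
      _ ≤ C * ‖ζ‖ ^ (-σ) := by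
          gcongr
          exact (Real.rpow_le_rpow hζ0.le hsmall hσ0.le).trans (le_max_left _ _)
  · obtain ⟨N, h1, h2, h3⟩ := exists_contracted (ω := ω) ha hL hlam hw
      ((one_le_pow₀ hD1.le).trans hlarge.le)
    have hN : N₀ ≤ N := by
      have := (pow_lt_pow_iff_right₀ hD1).1 (hlarge.trans_le h3)
      omega
    obtain ⟨hfew, hnres⟩ := hN₀ N hN
    have hbad : δ * N < badCount L ρ i₁ β (reversed L N ω) N
        (ζ * ∏ n ∈ Finset.range (N * L), M.lam (ω n), w) := by
      by_contra hc
      exact hnres ⟨hw, _, h1, h2, not_lt.1 hc⟩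
    have hjj : j ≠ j' := fun h => ht (by rw [h])
    obtain ⟨K, hK1, hK2⟩ : ∃ K : ℕ, δ / 2 * N ≤ K + 1 ∧ (K : ℝ) ≤ δ / 2 * N := by
      refine ⟨⌊δ / 2 * N⌋₊, (Nat.lt_floor_add_one _).le, Nat.floor_le (by positivity)⟩
    have hpow := norm_planarFourier_le_gain_pow (M := M) (N := N) (L := L) (ω := ω) (K := K) hlam
      hjj hpm hj hj' hρ0 hρ ξ rfl (by
        have : (K : ℝ) + ((Finset.range N).filter fun m => ¬ HasRun L i₁ ω m).card <
          badCount L ρ i₁ β (reversed L N ω) N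
            (ζ * ∏ n ∈ Finset.range (N * L), M.lam (ω n), w) := by linarith
        exact_mod_cast this)
    calc ‖planarFourier (M.randomMeasure ω) ξ‖ ≤ κ ^ K := hpow
      _ = κ ^ (K : ℝ) := (Real.rpow_natCast _ _).symm
      _ ≤ κ ^ (-(δ / 2 + 1) + δ / 2 * ((N + 1 : ℕ) : ℝ)) :=
          Real.rpow_le_rpow_of_exponent_ge hκ0 hκ1.le (by push_cast; linarith)
      _ = κ ^ (-(δ / 2 + 1)) * (D ^ (N + 1)) ^ (-σ) := by
          rw [Real.rpow_add hκ0, Real.rpow_mul hκ0.le, ← hσ, Real.rpow_natCast,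
            ← Real.rpow_natCast D, ← Real.rpow_mul (by positivity), mul_comm _ (-σ),
            Real.rpow_mul (by positivity), Real.rpow_natCast]
      _ ≤ C * ‖ζ‖ ^ (-σ) := by
          gcongr ?_ * ?_
          · exact le_max_right _ _
          · exact Real.rpow_le_rpow_of_nonpos hζ0 h3 (by linarith)

end ErdosKahane

namespace ErdosKahane

/-! ### Measurability and the set of good pairs -/

section

variable {I : Type*} [Finite I] [MeasurableSpace I] [DiscreteMeasurableSpace I]

lemma isClosed_admissible {I : Type*} (β : I → ℂ) (a b η W : ℝ) : IsClosed (admissible β a b η W) := by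
  have h : admissible β a b η W = {w | ‖w‖ ≤ W} ∩ {w | η ≤ |(Complex.exp w).im|} ∩
      ⋂ i, {w | a ≤ ‖Complex.exp (w * β i)‖} ∩ {w | ‖Complex.exp (w * β i)‖ ≤ b} := by
    ext w
    simp only [admissible, Set.mem_inter_iff, Set.mem_iInter, Set.mem_ofPred_eq, and_assoc]
  rw [h]
  refine ((isClosed_le (by fun_prop) (by fun_prop)).inter
    (isClosed_le (by fun_prop) ?_)).inter (isClosed_iInter fun i =>
    (isClosed_le (by fun_prop) (by fun_prop)).inter (isClosed_le (by fun_prop) (by fun_prop)))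
  exact (Complex.continuous_im.comp Complex.continuous_exp).abs

lemma measurableSet_reversed_mem_closure (L N : ℕ) (F : (ℕ → I) → Set ℂ) :
    MeasurableSet {p : (ℕ → I) × ℂ | p.2 ∈ closure (F (reversed L N p.1))} := by
  -- only finitely many letters of the sequence matter
  have h : {p : (ℕ → I) × ℂ | p.2 ∈ closure (F (reversed L N p.1))} =
      ⋃ v : Fin (N * L + 1) → I, {p : (ℕ → I) × ℂ | ∀ j : Fin (N * L + 1), p.1 j = v j} ∩
        {p | p.2 ∈ closure (F fun n => v ⟨N * L - 1 - n, by omega⟩)} := by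
    ext p
    simp only [Set.mem_iUnion, Set.mem_inter_iff, Set.mem_ofPred_eq]
    constructor
    · exact fun hp => ⟨fun j => p.1 j, fun j => rfl, hp⟩
    · rintro ⟨v, hv, hp⟩
      convert hp using 4
      exact hv ⟨_, _⟩
  rw [h]
  refine MeasurableSet.iUnion fun v => MeasurableSet.inter ?_
    (isClosed_closure.measurableSet.preimage measurable_snd)
  have h2 : {p : (ℕ → I) × ℂ | ∀ j : Fin (N * L + 1), p.1 j = v j} =
      ⋂ j : Fin (N * L + 1), (fun p : (ℕ → I) × ℂ => p.1 j) ⁻¹' {v j} := by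
    ext p; simp
  rw [h2]
  exact MeasurableSet.iInter fun j => (measurableSet_singleton (v j)).preimage
    ((measurable_pi_apply (j : ℕ)).comp measurable_fst)

/-- The Fourier decay theorem in terms of the logarithmic parameter `w`, where the letter `i` has
the contraction `exp (-(w * β i))`. -/
theorem exists_good_set (q : PMF I) {i₁ : I} (hq : 0 < q i₁) {a b η α Bm : ℝ} (ha : 1 < a)
    (hb : 1 < b) (hη : 0 < η) (hα : 0 < α) (hBm : 0 ≤ Bm) :
    ∃ σ : ℝ → ℝ, (∀ pm, 0 < pm → 0 < σ pm) ∧ ∀ β : I → ℂ, β i₁ = 1 → (∀ i, ‖β i‖ ≤ Bm) → ∀ W : ℝ,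
      ∃ G : Set ((ℕ → I) × ℂ), MeasurableSet G ∧
        (∀ᵐ ω ∂(bernoulliMeasure q),
          dimH {w | w ∈ admissible β a b η W ∧ (ω, w) ∉ G} ≤ ENNReal.ofReal α) ∧
        ∀ ω w, (ω, w) ∈ G → w ∈ admissible β a b η W → ∀ M : PlanarModel I,
          (∀ i, M.lam i = Complex.exp (-(w * β i))) → ∀ j j', M.t i₁ j ≠ M.t i₁ j' →
          ∀ pm, 0 < pm → pm ≤ (M.p i₁ j).toReal → pm ≤ (M.p i₁ j').toReal →
            M.randomMeasure ω ∈ FourierDecayClass (σ pm) := by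
  classical
  obtain ⟨δ, hδ, hL⟩ := exists_dimH_resonant_le (I := I) ha hb hη hα hBm
  obtain ⟨L, ⟨ρ, hρ0, hρ, hdim⟩, hfew, hL0⟩ := (hL.and ((eventually_ae_few_blocks_without_run hq
    (half_pos hδ)).and (eventually_gt_atTop 0))).exists
  refine ⟨decayExponent b L ρ δ, fun pm hpm => decayExponent_pos hb hL0 hρ0 hρ hδ hpm,
    fun β hi₁ hβ W => ?_⟩
  obtain ⟨t, ht1, ht2, ht3⟩ := exists_measurable_superset_of_null (ae_iff.1 hfew)
  set S : ℕ → Set ((ℕ → I) × ℂ) := fun N =>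
    {p | p.2 ∈ closure (resonantSet a b η W L ρ δ i₁ β (reversed L N p.1) N)} with hS
  have hSm : ∀ N, MeasurableSet (S N) := fun N =>
    measurableSet_reversed_mem_closure L N fun e => resonantSet a b η W L ρ δ i₁ β e N
  refine ⟨(Prod.fst ⁻¹' tᶜ) ∩ ⋃ n : ℕ, ⋂ N : ℕ, ⋂ _ : n ≤ N, (S N)ᶜ,
    (measurable_fst ht2.compl).inter (MeasurableSet.iUnion fun n => MeasurableSet.iInter fun N =>
      MeasurableSet.iInter fun _ => (hSm N).compl), ?_, ?_⟩
  · have hae : ∀ᵐ ω ∂(bernoulliMeasure q), ω ∉ t := measure_eq_zero_iff_ae_notMem.1 ht3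
    filter_upwards [hae] with ω hω
    refine (dimH_mono ?_).trans (hdim i₁ β hi₁ hβ W fun N => reversed L N ω)
    rintro w ⟨-, hw⟩
    refine frequently_atTop.2 fun n => ?_
    by_contra! hc
    exact hw ⟨hω, Set.mem_iUnion.2 ⟨n, Set.mem_iInter₂.2 hc⟩⟩
  · rintro ω w ⟨hω, hw⟩ hwa M hlam j j' htj pm hpm hj hj'
    obtain ⟨n, hn⟩ := Set.mem_iUnion.1 hw
    refine randomMeasure_mem_fourierDecayClass ha hL0 hρ0 hρ hδ hpm hwa hlam htj hj hj' ?_ ?_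
    · by_contra hc
      exact hω (ht1 hc)
    · filter_upwards [eventually_ge_atTop n] with N hN hc
      exact Set.mem_iInter₂.1 hn N hN (subset_closure hc)

end

/-! ### Back to the original parameters -/

section

variable {I : Type*} [Finite I] [MeasurableSpace I] [DiscreteMeasurableSpace I]

/-- The precise statement, transported by `θ = exp w`. -/
theorem exists_good_set_halfAnnulus (q : PMF I) {i₁ : I} (hq : 0 < q i₁) {a b η pmin α : ℝ}
    (ha : 1 < a) (hab : a < b) (hη : 0 < η) (hpmin : 0 < pmin) (hα : 0 < α) :
    ∃ σ : ℝ, 0 < σ ∧ ∀ β : I → ℂ, β i₁ = 1 →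
      (∀ i, ‖β i‖ ≤ (Real.log b + Real.pi) / Real.log a) →
      ∃ G : Set ((ℕ → I) × ℂ), MeasurableSet G ∧ G ⊆ Set.univ ×ˢ halfAnnulus a b η ∧
        (∀ᵐ ω ∂(bernoulliMeasure q),
          dimH {θ : ℂ | θ ∈ halfAnnulus a b η ∧ (ω, θ) ∉ G} ≤ ENNReal.ofReal α) ∧
        ∀ (ω : ℕ → I) (θ : ℂ), (ω, θ) ∈ G → ∀ M : PlanarModel I,
          (∃ j j' : Fin (M.k i₁), M.t i₁ j ≠ M.t i₁ j') →
          (∀ j : Fin (M.k i₁), pmin ≤ (M.p i₁ j).toReal) →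
          (∀ i, M.lam i = θ ^ (-β i) ∧ a ≤ ‖M.lam i‖⁻¹ ∧ ‖M.lam i‖⁻¹ ≤ b) →
          M.randomMeasure ω ∈ FourierDecayClass σ := by
  have hla := Real.log_pos ha
  have hlb := Real.log_pos (ha.trans hab)
  obtain ⟨σ, hσ, h⟩ := exists_good_set q hq ha (ha.trans hab) hη hα
    (Bm := (Real.log b + Real.pi) / Real.log a) (by have := Real.pi_pos; positivity)
  refine ⟨σ pmin, hσ _ hpmin, fun β hi₁ hβ => ?_⟩
  obtain ⟨G, hGm, hGd, hG⟩ := h β hi₁ hβ (Real.log b + Real.pi)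
  set K := admissible β a b η (Real.log b + Real.pi)
  have hann : MeasurableSet (halfAnnulus a b η) :=
    ((isClosed_le continuous_const continuous_norm).measurableSet).inter
      ((isClosed_le continuous_norm continuous_const).measurableSet.inter
        (isOpen_lt continuous_const Complex.continuous_im).measurableSet)
  have hlog : Measurable fun p : (ℕ → I) × ℂ => Complex.log p.2 :=
    Complex.measurable_log.comp measurable_snd
  have hpos : ∀ θ ∈ halfAnnulus a b η, θ ≠ 0 := fun θ hθ h0 => by
    have := hθ.1
    rw [h0, norm_zero] at this
    linarith
  refine ⟨{p | p.2 ∈ halfAnnulus a b η ∧ (Complex.log p.2 ∉ K ∨ (p.1, Complex.log p.2) ∈ G)},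
    (measurable_snd hann).inter (((isClosed_admissible β a b η _).measurableSet.compl.preimage
      hlog).union (hGm.preimage (measurable_fst.prodMk hlog))), fun p hp => ⟨trivial, hp.1⟩, ?_, ?_⟩
  · filter_upwards [hGd] with ω hω
    refine (dimH_mono (t := Complex.exp '' {w | w ∈ K ∧ (ω, w) ∉ G}) ?_).trans
      ((ContDiffOn.dimH_image_le (s := Set.univ) (Complex.contDiff_exp (𝕜 := ℝ)).contDiffOn
        convex_univ (Set.subset_univ _)).trans hω)
    rintro θ ⟨hθ, hθG⟩
    have h1 : Complex.log θ ∈ K ∧ (ω, Complex.log θ) ∉ G := by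
      by_contra hc
      refine hθG ⟨hθ, ?_⟩
      by_contra! hc'
      exact hc hc'
    exact ⟨Complex.log θ, h1, Complex.exp_log (hpos θ hθ)⟩
  · rintro ω θ ⟨hθ, hor⟩ M ⟨j, j', hj⟩ hp hlam
    have hθ0 := hpos θ hθ
    have hlam' : ∀ i, M.lam i = Complex.exp (-(Complex.log θ * β i)) := fun i => by
      rw [(hlam i).1, Complex.cpow_def_of_ne_zero hθ0, mul_neg]
    have hK : Complex.log θ ∈ K := by
      refine ⟨?_, ?_, fun i => ?_⟩
      · refine (Complex.norm_le_abs_re_add_abs_im _).trans (add_le_add ?_ ?_)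
        · rw [Complex.log_re, abs_of_nonneg (Real.log_nonneg (ha.le.trans hθ.1))]
          exact Real.log_le_log (norm_pos_iff.2 hθ0) hθ.2.1
        · rw [Complex.log_im]; exact Complex.abs_arg_le_pi θ
      · rw [Complex.exp_log hθ0]; exact hθ.2.2.le.trans (le_abs_self _)
      · have := (hlam i).2
        rwa [hlam', Complex.exp_neg, norm_inv, inv_inv] at this
    rcases hor with hor | hor
    · exact absurd hK hor
    · exact hG ω _ hor hK M hlam' j j' hj pmin hpmin (hp j) (hp j')

/-- The points at which `exp (-(c * log l))` is real form a set of dimension at most one. -/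
lemma dimH_real_le_one {c : ℂ} (hc : c ≠ 0) :
    dimH {l : ℂ | l ≠ 0 ∧ (Complex.exp (-(c * Complex.log l))).im = 0} ≤ 1 := by
  have hsub : {l : ℂ | l ≠ 0 ∧ (Complex.exp (-(c * Complex.log l))).im = 0} ⊆
      ⋃ k : ℤ, Set.range fun x : ℝ =>
        Complex.exp (-(((x : ℂ) + (k * Real.pi : ℝ) * Complex.I) / c)) := by
    rintro l ⟨hl, him⟩
    rw [Complex.exp_im, mul_eq_zero, or_iff_right (Real.exp_ne_zero _), Real.sin_eq_zero_iff] at him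
    obtain ⟨k, hk⟩ := him
    refine Set.mem_iUnion.2 ⟨k, (-(c * Complex.log l)).re, ?_⟩
    simp only
    rw [hk, Complex.re_add_im, neg_div, mul_div_cancel_left₀ _ hc, neg_neg, Complex.exp_log hl]
  refine (dimH_mono hsub).trans ?_
  rw [dimH_iUnion]
  refine iSup_le fun k => ?_
  have h : ContDiff ℝ 1 fun x : ℝ =>
      Complex.exp (-(((x : ℂ) + (k * Real.pi : ℝ) * Complex.I) / c)) := by
    have h1 : ContDiff ℝ 1 fun x : ℝ => (x : ℂ) := Complex.ofRealCLM.contDiff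
    exact ((h1.add contDiff_const).div_const c).neg.cexp
  simpa using h.dimH_range_le

/-- The region of logarithmic parameters used at stage `n` of an exhaustion. -/
def exhaustion {I : Type*} (β : I → ℂ) (n : ℕ) : Set ℂ :=
  admissible β (1 + 1 / ((n : ℝ) + 1)) (n + 2) (1 / ((n : ℝ) + 1)) n

lemma exists_mem_exhaustion {I : Type*} [Finite I] {β : I → ℂ} {w : ℂ} (him : (Complex.exp w).im ≠ 0)
    (hw : ∀ i, 1 < ‖Complex.exp (w * β i)‖) : ∃ n, w ∈ exhaustion β n := by
  have h0 : Tendsto (fun n : ℕ => 1 / ((n : ℝ) + 1)) atTop (𝓝 0) :=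
    tendsto_one_div_add_atTop_nhds_zero_nat
  have hat : Tendsto (fun n : ℕ => (n : ℝ)) atTop atTop := tendsto_natCast_atTop_atTop
  have e1 := hat.eventually_ge_atTop ‖w‖
  have e2 := h0.eventually_le_const (abs_pos.2 him)
  have e3 : ∀ᶠ n : ℕ in atTop, ∀ i, 1 / ((n : ℝ) + 1) ≤ ‖Complex.exp (w * β i)‖ - 1 :=
    eventually_all.2 fun i => h0.eventually_le_const (sub_pos.2 (hw i))
  have e4 : ∀ᶠ n : ℕ in atTop, ∀ i, ‖Complex.exp (w * β i)‖ ≤ n :=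
    eventually_all.2 fun i => hat.eventually_ge_atTop _
  obtain ⟨n, h1, h2, h3, h4⟩ := (e1.and (e2.and (e3.and e4))).exists
  exact ⟨n, h1, h2, fun i => ⟨by linarith [h3 i], by linarith [h4 i]⟩⟩

lemma exists_good_set_exhaustion (q : PMF I) {i₀ : I} (hq : 0 < q i₀) {β : I → ℂ} (hi₀ : β i₀ = 1)
    (n : ℕ) : ∃ G : Set ((ℕ → I) × ℂ), MeasurableSet G ∧
      (∀ᵐ ω ∂(bernoulliMeasure q), dimH {w | w ∈ exhaustion β n ∧ (ω, w) ∉ G} ≤ 1) ∧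
      ∀ ω w, (ω, w) ∈ G → w ∈ exhaustion β n → ∀ M : PlanarModel I,
        (∀ i, M.lam i = Complex.exp (-(w * β i))) → ∀ j j', M.t i₀ j ≠ M.t i₀ j' →
          M.randomMeasure ω ∈ PowerFourierDecay := by
  obtain ⟨Bm, hBm⟩ := (Set.finite_range fun i => ‖β i‖).bddAbove
  have hn : (0 : ℝ) < 1 / ((n : ℝ) + 1) := by positivity
  have hβ : ∀ i, ‖β i‖ ≤ Bm := fun i => hBm ⟨i, rfl⟩
  obtain ⟨σ, hσ, h⟩ := exists_good_set q hq (a := 1 + 1 / ((n : ℝ) + 1)) (b := n + 2)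
    (by linarith) (by have : (0 : ℝ) ≤ n := n.cast_nonneg
                      linarith) hn one_pos ((norm_nonneg _).trans (hβ i₀))
  obtain ⟨G, hG1, hG2, hG3⟩ := h β hi₀ hβ n
  refine ⟨G, hG1, by simpa [exhaustion] using hG2, fun ω w hw hwn M hlam j j' ht => ?_⟩
  have hp : ∀ j, 0 < (M.p i₀ j).toReal := fun j =>
    ENNReal.toReal_pos (M.p_pos i₀ j).ne' ((M.p i₀).apply_ne_top j)
  have hpm : 0 < min (M.p i₀ j).toReal (M.p i₀ j').toReal := lt_min (hp j) (hp j')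
  exact Set.mem_iUnion.2 ⟨⟨_, hσ _ hpm⟩,
    hG3 ω w hw hwn M hlam j j' ht _ hpm (min_le_left _ _) (min_le_right _ _)⟩

/-- The qualitative statement: for each letter `i₀` of positive probability the parameters
`w = -(β i₀ * log l)` are exhausted by countably many admissible regions and the curves on which
`exp w` is real. -/
theorem exists_good_set_disc (q : PMF I) (β : I → ℂ) (hβ : ∀ i, β i ≠ 0) :
    ∃ G : Set ((ℕ → I) × ℂ), MeasurableSet G ∧ G ⊆ Set.univ ×ˢ Metric.ball (0 : ℂ) 1 ∧
      (∀ᵐ ω ∂(bernoulliMeasure q), dimH {l : ℂ | (0 < ‖l‖ ∧ ‖l‖ < 1) ∧ (ω, l) ∉ G} ≤ 1) ∧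
      ∀ (ω : ℕ → I) (l : ℂ), (ω, l) ∈ G → ∀ M : PlanarModel I,
        M.selection = bernoulliMeasure q → M.NonDegenerate →
        (∀ i, M.lam i = l ^ β i ∧ ‖l ^ β i‖ < 1) → M.randomMeasure ω ∈ PowerFourierDecay := by
  set J := {i : I // 0 < q i}
  have hβJ : ∀ i₀ : J, (fun i => β i / β i₀) i₀.1 = 1 := fun i₀ => div_self (hβ i₀)
  choose G hGm hGd hG using fun (i₀ : J) (n : ℕ) =>
    exists_good_set_exhaustion q i₀.2 (β := fun i => β i / β i₀) (hβJ i₀) n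
  set K : J → ℕ → Set ℂ := fun i₀ n => exhaustion (fun i => β i / β i₀) n with hK
  set w : J → ℂ → ℂ := fun i₀ l => -(β i₀ * Complex.log l) with hw
  have hwm : ∀ i₀, Measurable (w i₀) := fun i₀ => (Complex.measurable_log.const_mul _).neg
  have hwβ : ∀ i₀ l i, w i₀ l * (β i / β i₀) = -(Complex.log l * β i) := fun i₀ l i => by
    rw [hw]
    have := hβ i₀
    field_simp
  set Bad : Set ℂ := ⋃ i, {l | 1 ≤ ‖Complex.exp (Complex.log l * β i)‖} with hBad
  have hBadm : MeasurableSet Bad := MeasurableSet.iUnion fun i => measurableSet_le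
    measurable_const (Complex.measurable_exp.comp (Complex.measurable_log.mul_const _)).norm
  refine ⟨{p | (p.2 ∈ Metric.ball (0 : ℂ) 1 ∧ p.2 ≠ 0) ∧ (p.2 ∈ Bad ∨
    p ∈ ⋂ i₀ : J, ⋃ n : ℕ, {p : (ℕ → I) × ℂ | w i₀ p.2 ∈ K i₀ n ∧ (p.1, w i₀ p.2) ∈ G i₀ n})},
    ?_, fun p hp => ⟨trivial, hp.1.1⟩, ?_, ?_⟩
  · refine MeasurableSet.inter ?_ (MeasurableSet.union (measurable_snd hBadm)
      (MeasurableSet.iInter fun i₀ => MeasurableSet.iUnion fun n => MeasurableSet.inter ?_ ?_))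
    · exact (measurableSet_ball.inter (measurableSet_singleton (0 : ℂ)).compl).preimage
        measurable_snd
    · exact (isClosed_admissible _ _ _ _ _).measurableSet.preimage ((hwm i₀).comp measurable_snd)
    · exact (hGm i₀ n).preimage (measurable_fst.prodMk ((hwm i₀).comp measurable_snd))
  · filter_upwards [ae_all_iff.2 fun i₀ => ae_all_iff.2 (hGd i₀)] with ω hω
    have hsub : {l : ℂ | (0 < ‖l‖ ∧ ‖l‖ < 1) ∧ (ω, l) ∉ {p : (ℕ → I) × ℂ |
        (p.2 ∈ Metric.ball (0 : ℂ) 1 ∧ p.2 ≠ 0) ∧ (p.2 ∈ Bad ∨ p ∈ ⋂ i₀ : J, ⋃ n : ℕ,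
          {p : (ℕ → I) × ℂ | w i₀ p.2 ∈ K i₀ n ∧ (p.1, w i₀ p.2) ∈ G i₀ n})}} ⊆
        ⋃ i₀ : J, {l : ℂ | l ≠ 0 ∧ (Complex.exp (-(β i₀ * Complex.log l))).im = 0} ∪
          ⋃ n : ℕ, (fun z => Complex.exp (-(z / β i₀))) '' {z | z ∈ K i₀ n ∧ (ω, z) ∉ G i₀ n} := by
      rintro l ⟨⟨hl0, hl1⟩, hl⟩
      have hl0' : l ≠ 0 := norm_pos_iff.1 hl0
      have hl2 : l ∉ Bad ∧ ∃ i₀ : J, ∀ n : ℕ, ¬ (w i₀ l ∈ K i₀ n ∧ (ω, w i₀ l) ∈ G i₀ n) := by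
        by_contra hc
        refine hl ⟨⟨by simpa using hl1, hl0'⟩, ?_⟩
        by_contra! hc'
        refine hc ⟨hc'.1, ?_⟩
        simpa using hc'.2
      obtain ⟨hl3, i₀, hi₀⟩ := hl2
      refine Set.mem_iUnion.2 ⟨i₀, ?_⟩
      by_cases him : (Complex.exp (w i₀ l)).im = 0
      · exact Or.inl ⟨hl0', him⟩
      · right
        obtain ⟨n, hn⟩ := exists_mem_exhaustion (β := fun i => β i / β i₀) him fun i => by
          have h1 : ‖Complex.exp (Complex.log l * β i)‖ < 1 := by
            by_contra! hc
            exact hl3 (Set.mem_iUnion.2 ⟨i, hc⟩)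
          rw [hwβ, Complex.exp_neg, norm_inv]
          exact one_lt_inv_iff₀.2 ⟨norm_pos_iff.2 (Complex.exp_ne_zero _), h1⟩
        refine Set.mem_iUnion.2 ⟨n, w i₀ l, ⟨hn, fun hc => hi₀ n ⟨hn, hc⟩⟩, ?_⟩
        simp only [hw]
        rw [neg_div, mul_div_cancel_left₀ _ (hβ i₀), neg_neg, Complex.exp_log hl0']
    refine (dimH_mono hsub).trans ?_
    rw [dimH_iUnion]
    refine iSup_le fun i₀ => ?_
    rw [dimH_union, dimH_iUnion]
    refine max_le (dimH_real_le_one (hβ i₀)) (iSup_le fun n => ?_)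
    have hsm : ContDiff ℝ 1 fun z : ℂ => Complex.exp (-(z / β i₀)) :=
      (contDiff_id.div_const _).neg.cexp
    exact (hsm.contDiffOn.dimH_image_le convex_univ (Set.subset_univ _)).trans (hω i₀ n)
  · rintro ω l ⟨⟨-, hl0⟩, hor⟩ M hsel ⟨i₀, hi₀, j, j', hjj⟩ hlam
    have hlam1 : ∀ i, M.lam i = Complex.exp (Complex.log l * β i) := fun i => by
      rw [(hlam i).1, Complex.cpow_def_of_ne_zero hl0]
    have hq : 0 < q i₀ := by
      rw [hsel, bernoulliMeasure] at hi₀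
      have h1 : {ω : ℕ → I | ω 0 = i₀} = (fun ω => ω 0) ⁻¹' {i₀} := rfl
      rw [h1, ← Measure.map_apply (measurable_pi_apply 0) (measurableSet_singleton i₀),
        Measure.infinitePi_map_eval (fun _ : ℕ => q.toMeasure) 0,
        PMF.toMeasure_apply_singleton _ _ (measurableSet_singleton _)] at hi₀
      exact hi₀
    rcases hor with hor | hor
    · obtain ⟨i, hi⟩ := Set.mem_iUnion.1 hor
      have := M.norm_lam_lt_one i
      rw [hlam1] at this
      exact absurd hi (not_le.2 this)
    · obtain ⟨n, hn1, hn2⟩ := Set.mem_iUnion.1 (Set.mem_iInter.1 hor ⟨i₀, hq⟩)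
      refine hG ⟨i₀, hq⟩ n ω _ hn2 hn1 M (fun i => ?_) j j' fun ht => hjj ?_
      · rw [hwβ, neg_neg, hlam1]
      · funext z
        rw [PlanarModel.map, PlanarModel.map, ht]

end

end ErdosKahane

end

theorem theorem1p5 {I : Type*} [Finite I] [MeasurableSpace I] [DiscreteMeasurableSpace I]
    (q : PMF I) :
    -- the qualitative statement
    (∀ β : I → ℂ, (∀ i, β i ≠ 0) →
      ∃ G : Set ((ℕ → I) × ℂ), MeasurableSet G ∧ G ⊆ Set.univ ×ˢ Metric.ball (0 : ℂ) 1 ∧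
        (∀ᵐ ω ∂(bernoulliMeasure q),
          dimH {l : ℂ | (0 < ‖l‖ ∧ ‖l‖ < 1) ∧ (ω, l) ∉ G} ≤ 1) ∧
        ∀ (ω : ℕ → I) (l : ℂ), (ω, l) ∈ G →
          ∀ M : PlanarModel I, M.selection = bernoulliMeasure q → M.NonDegenerate →
            (∀ i, M.lam i = l ^ β i ∧ ‖l ^ β i‖ < 1) →
            M.randomMeasure ω ∈ PowerFourierDecay) ∧
    -- the precise statement, for a fully supported Bernoulli measure and a distinguished letter
    ((∀ i, 0 < q i) →
      ∀ (i₁ : I) (a b η pmin pmax α : ℝ), 1 < a → a < b → 0 < η →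
        0 < pmin → pmin ≤ pmax → pmax < 1 → 0 < α →
        ∃ σ : ℝ, 0 < σ ∧
          ∀ β : I → ℂ, β i₁ = 1 →
            (∀ i, Real.log a / (Real.log b + Real.pi) ≤ ‖β i‖ ∧
              ‖β i‖ ≤ (Real.log b + Real.pi) / Real.log a) →
            ∃ G : Set ((ℕ → I) × ℂ), MeasurableSet G ∧ G ⊆ Set.univ ×ˢ halfAnnulus a b η ∧
              (∀ᵐ ω ∂(bernoulliMeasure q),
                dimH {θ : ℂ | θ ∈ halfAnnulus a b η ∧ (ω, θ) ∉ G} ≤ ENNReal.ofReal α) ∧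
              ∀ (ω : ℕ → I) (θ : ℂ), (ω, θ) ∈ G →
                ∀ M : PlanarModel I, M.selection = bernoulliMeasure q → M.NonDegenerate →
                  (∃ j j' : Fin (M.k i₁), M.t i₁ j ≠ M.t i₁ j') →
                  (∀ j : Fin (M.k i₁), (M.p i₁ j).toReal ∈ Set.Icc pmin pmax) →
                  (∀ i, M.lam i = θ ^ (-β i) ∧ a ≤ ‖M.lam i‖⁻¹ ∧ ‖M.lam i‖⁻¹ ≤ b) →
                  M.randomMeasure ω ∈ FourierDecayClass σ) := by
  refine ⟨fun β hβ => ErdosKahane.exists_good_set_disc q β hβ,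
    fun hq i₁ a b η pmin pmax α ha hab hη hpmin _ _ hα => ?_⟩
  obtain ⟨σ, hσ, h⟩ := ErdosKahane.exists_good_set_halfAnnulus q (hq i₁) ha hab hη hpmin hα
  refine ⟨σ, hσ, fun β hβ₁ hβ => ?_⟩
  obtain ⟨G, hGm, hGs, hGd, hG⟩ := h β hβ₁ fun i => (hβ i).2
  exact ⟨G, hGm, hGs, hGd, fun ω θ hωθ M _ _ ht hp hlam => hG ω θ hωθ M ht (fun j => (hp j).1) hlam⟩
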